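/- A max-flow instance consists of a finite directed graph $G=(V,E)$ (parallel edges allowed), vertices $s\neq t$ and capacities $c:E\to\mathbb{R}_{\ge 0}$. The agents of the max-flow game are the edges; the worth of $S\subseteq E$ is the maximum value of an $s$-$t$ flow using only edges of $S$. An imputation is a vector $p\in\mathbb{R}_{\ge0}^E$ whose entries sum to the worth of $E$. A dual solution is a pair $(\delta,\pi)\in\mathbb{R}_{\ge0}^E\times\mathbb{R}_{\ge0}^V$ with $\pi_i-\pi_j\le\delta_{ij}$ for all edges $(i,j)$ and $\pi_s-\pi_t\ge1$; it is optimal if it minimizes $\sum_e c_e\delta_e$. The Owen set consists of the vectors $(c_e\delta_e)_{e\in E}$ for optimal dual solutions $(\delta,\pi)$. **(1) Polynomial time.** There is one program for a random access machine with the following property. Given an instance with $n$ vertices and $m$ edges and an imputation $p$, it halts after a number of steps (arithmetic operations and comparisons of numbers at unit cost) that is polynomial in $n+m$, and it answers whether $p$ belongs to the Owen set. If it does, the program also outputs an optimal dual solution $(\delta,\pi)$ with $p_e=c_e\delta_e$ for all $e$ and $\pi_t=0$. If $c$ and $p$ are rational, the bit cost of the computation is moreover polynomial in the length of the input. **(2)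 The combinatorial algorithm.** Let all capacities be positive, let $f$ be a maximum flow and let $p$ be an imputation. An edge is essential if every maximum flow saturates it. The Picard–Queyranne structure $G'=(V',E')$ arises from the residual graph of $f$ by shrinking each strongly connected component to a node and deleting loops; let $t'$ be the node containing $t$. The algorithm answers "No" if $p_e>0$ for some inessential $e$. Otherwise it sets $\delta_e=p_e/c_e$ for all $e$ and $\pi_{t'}=0$ and fixes $t'$, all other nodes being free. While there are free nodes, it picks an arc of $E'$ that is the reversal of an essential edge $e$ and that leads from a fixed node $i$ to a free node $j$, sets $\pi_j=\pi_i+\delta_e$, and fixes $j$. When all nodes are fixed, every vertex of $G$ receives the potential of its node, and the algorithm answers "Yes" if $(\delta,\pi)$ is a dual solution and "No" otherwise. Then, for all choices of the arcs: (a) The loop makes at most $|V'|-1$ iterations. (b) At every stage of the loop, $p$ belongs to the Owen set if and only if $p_e=0$ for all inessential $e$ and the potentials fixed so far extend to some $\pi$ such that $(\delta,\pi)$ is a dual solution. The fixed potentials agree with those of every optimal dual solution that yields $p$ and has potential $0$ at $t$. (c) If every node of $V'$ is the head or the tail of some essential edge, then the loop never gets stuck: as long as there is a free node, there is an arc to pick.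 (d) Whenever the loop has fixed all nodes, the answer is correct: $p$ belongs to the Owen set if and only if no inessential edge is paid and the resulting $(\delta,\pi)$ is a dual solution. -/

import Mathlib

open Finset

/-! ### Max-flow instances, flows and the max-flow game -/

/-- A max-flow instance: a directed graph with vertices `V` and edges `E` (an edge `e` goes from
`src e` to `tgt e`), a source `s`, a sink `t ≠ s` and nonnegative real capacities `c`. -/
structure FlowNetwork (V E : Type*) where
  src : E → V
  tgt : E → V
  s : V
  t : V
  s_ne_t : s ≠ t
  c : E → ℝ
  c_nonneg : ∀ e, 0 ≤ c e

namespace FlowNetwork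

variable {V E : Type*} [Fintype E] [DecidableEq V] (N : FlowNetwork V E)

/-- Flow leaving `v` minus flow entering `v`. -/
def netOut (f : E → ℝ) (v : V) : ℝ :=
  (∑ e with N.src e = v, f e) - ∑ e with N.tgt e = v, f e

/-- `f` is an `s`-`t` flow: capacity constraints, and conservation outside `s` and `t`. -/
def IsFlow (f : E → ℝ) : Prop :=
  (∀ e, 0 ≤ f e ∧ f e ≤ N.c e) ∧ ∀ v, v ≠ N.s → v ≠ N.t → N.netOut f v = 0

/-- The value of a flow, the net flow out of the source. -/
def value (f : E → ℝ) : ℝ := N.netOut f N.s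

def IsMaxFlow (f : E → ℝ) : Prop :=
  N.IsFlow f ∧ ∀ g, N.IsFlow g → N.value g ≤ N.value f

/-- The characteristic function of the max-flow game, whose agents are the edges: the worth of a
coalition `S` is the maximum value of a flow that uses the edges of `S` only. -/
noncomputable def worth (S : Finset E) : ℝ :=
  sSup {x | ∃ f, N.IsFlow f ∧ (∀ e, e ∉ S → f e = 0) ∧ x = N.value f}

/-- An imputation: nonnegative shares that sum to the worth of the grand coalition. -/
def IsImputation (p : E → ℝ) : Prop :=
  (∀ e, 0 ≤ p e) ∧ ∑ e, p e = N.worth Finset.univ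

/-! ### The dual linear program and the Owen set -/

/-- Feasibility of the lengths `δ` and the potentials `π` for the dual of the max-flow LP. -/
def DualFeasible (δ : E → ℝ) (π : V → ℝ) : Prop :=
  (∀ e, 0 ≤ δ e - π (N.src e) + π (N.tgt e)) ∧ 1 ≤ π N.s - π N.t ∧
    (∀ e, 0 ≤ δ e) ∧ ∀ v, 0 ≤ π v

def DualOptimal (δ : E → ℝ) (π : V → ℝ) : Prop :=
  N.DualFeasible δ π ∧
    ∀ δ' π', N.DualFeasible δ' π' → ∑ e, N.c e * δ e ≤ ∑ e, N.c e * δ' e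

/-- The Owen set: the profit vectors `c * δ` of the optimal dual solutions. -/
def owenSet : Set (E → ℝ) :=
  {p | ∃ δ π, N.DualOptimal δ π ∧ ∀ e, p e = N.c e * δ e}

/-! ### The Picard–Queyranne structure -/

/-- An edge is essential if every maximum flow saturates it. -/
def Essential (e : E) : Prop := ∀ f, N.IsMaxFlow f → f e = N.c e

/-- A residual arc is an edge with a direction: `(e, true)` is `e` itself, `(e, false)` is the
reversal of `e`. This is its tail. -/
def arcTail (a : E × Bool) : V := bif a.2 then N.src a.1 else N.tgt a.1

/-- The head of a residual arc. -/
def arcHead (a : E × Bool) : V := bif a.2 then N.tgt a.1 else N.src a.1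

/-- The arcs of the residual graph under `f`: edges below capacity, reversals of edges with
positive flow. -/
def residualArcs (f : E → ℝ) : Set (E × Bool) :=
  {a | (a.2 = true ∧ f a.1 < N.c a.1) ∨ (a.2 = false ∧ 0 < f a.1)}

def ResidualAdj (f : E → ℝ) (u v : V) : Prop :=
  ∃ a ∈ N.residualArcs f, N.arcTail a = u ∧ N.arcHead a = v

/-- Two vertices are equivalent if they lie in the same strongly connected component of the
residual graph. -/
def sccSetoid (f : E → ℝ) : Setoid V where
  r u v := Relation.ReflTransGen (N.ResidualAdj f) u v ∧
    Relation.ReflTransGen (N.ResidualAdj f) v u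
  iseqv :=
    ⟨fun _ => ⟨.refl, .refl⟩, fun h => ⟨h.2, h.1⟩,
      fun h h' => ⟨h.1.trans h'.1, h'.2.trans h.2⟩⟩

/-- The nodes of the Picard–Queyranne structure: the strongly connected components of the
residual graph. -/
def PQNode (f : E → ℝ) : Type _ := Quotient (N.sccSetoid f)

/-- The node that contains the vertex `v`. -/
def node (f : E → ℝ) (v : V) : N.PQNode f := Quotient.mk (N.sccSetoid f) v

/-- The arcs of the Picard–Queyranne structure: the residual arcs that do not become loops when
the components are shrunk. -/
def pqArcs (f : E → ℝ) : Set (E × Bool) :=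
  {a | a ∈ N.residualArcs f ∧ N.node f (N.arcTail a) ≠ N.node f (N.arcHead a)}

/-! ### The propagation algorithm -/

/-- The lengths that the algorithm assigns to the edges. -/
noncomputable def shareLength (p : E → ℝ) (e : E) : ℝ := p e / N.c e

/-- A state of the algorithm: a partial assignment of potentials to the nodes. The nodes with a
potential are the fixed ones, the others are free. At the start only the node of `t` is fixed. -/
noncomputable def startState (f : E → ℝ) : N.PQNode f → Option ℝ :=
  open Classical in fun X => if X = N.node f N.t then some 0 else none

/-- One iteration of the loop: pick an arc of the Picard–Queyranne structure that comes from an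
essential edge and leads from a fixed node to a free one, and fix the potential of its head as the
potential of its tail plus the length of the edge. -/
def PropStep (f p : E → ℝ) (σ σ' : N.PQNode f → Option ℝ) : Prop :=
  open Classical in
  ∃ a ∈ N.pqArcs f, N.Essential a.1 ∧ ∃ x : ℝ,
    σ (N.node f (N.arcTail a)) = some x ∧ σ (N.node f (N.arcHead a)) = none ∧
    σ' = Function.update σ (N.node f (N.arcHead a)) (some (x + N.shareLength p a.1))

/-- `σ` can be reached by `k` iterations of the loop, for some choice of the arcs. -/
inductive Propagates (f p : E → ℝ) : ℕ → (N.PQNode f → Option ℝ) → Prop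
  | start : Propagates f p 0 (N.startState f)
  | step {k : ℕ} {σ σ' : N.PQNode f → Option ℝ} :
      Propagates f p k σ → N.PropStep f p σ σ' → Propagates f p (k + 1) σ'

/-- No free node is left: the loop has ended. -/
def Finished (f : E → ℝ) (σ : N.PQNode f → Option ℝ) : Prop := ∀ X, (σ X).isSome

/-- The answer of the algorithm, for a loop that ended in the state `σ`, is "Yes": no inessential
edge is paid, and the lengths together with the potentials in `σ`, transferred to the vertices of
the graph, are a feasible dual solution. -/
def AnswersYes (f p : E → ℝ) (σ : N.PQNode f → Option ℝ) : Prop :=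
  (∀ e, ¬ N.Essential e → p e = 0) ∧
    ∃ π : V → ℝ, (∀ v, σ (N.node f v) = some (π v)) ∧ N.DualFeasible (N.shareLength p) π

end FlowNetwork

/-! ### A random access machine with a step count -/

namespace Ram

/-- Memory over a field `K`: natural-number registers, arrays of natural numbers, and arrays of
elements of `K`. -/
structure Memory (K : Type*) where
  reg : ℕ → ℕ
  arr : ℕ → ℕ → ℕ
  num : ℕ → ℕ → K

inductive Op
  | add | sub | mul | div

def Op.apply {K : Type*} [Field K] : Op → K → K → K
  | .add, x, y => x + y
  | .sub, x, y => x - y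
  | .mul, x, y => x * y
  | .div, x, y => x / y

/-- Elementary instructions. Array positions are given by registers. -/
inductive Instr
  /-- `reg x := 0` -/
  | zero (x : ℕ)
  /-- `reg x := reg x + 1` -/
  | succ (x : ℕ)
  /-- `reg x := reg y` -/
  | copy (x y : ℕ)
  /-- `reg x := arr a [reg i]` -/
  | load (x a i : ℕ)
  /-- `arr a [reg i] := reg x` -/
  | store (a i x : ℕ)
  /-- `num a [reg i] := 0` -/
  | numZero (a i : ℕ)
  /-- `num a [reg i] := 1` -/
  | numOne (a i : ℕ)
  /-- `num a [reg i] := num b [reg j] o num d [reg k]` -/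
  | numOp (o : Op) (a i b j d k : ℕ)

inductive Test
  /-- `reg x < reg y` -/
  | lt (x y : ℕ)
  /-- `num a [reg i] ≤ num b [reg j]` -/
  | numLe (a i b j : ℕ)

inductive Prog
  | skip
  | instr (c : Instr)
  | seq (P Q : Prog)
  | ite (b : Test) (P Q : Prog)
  | loop (b : Test) (P : Prog)

section Semantics

variable {K : Type*} [Field K] [LinearOrder K]

def Memory.setReg (M : Memory K) (x v : ℕ) : Memory K :=
  { M with reg := Function.update M.reg x v }

def Memory.setArr (M : Memory K) (a i v : ℕ) : Memory K :=
  { M with arr := Function.update M.arr a (Function.update (M.arr a) i v) }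

def Memory.setNum (M : Memory K) (a i : ℕ) (v : K) : Memory K :=
  { M with num := Function.update M.num a (Function.update (M.num a) i v) }

/-- The effect of an instruction. -/
def Instr.run (M : Memory K) : Instr → Memory K
  | .zero x => M.setReg x 0
  | .succ x => M.setReg x (M.reg x + 1)
  | .copy x y => M.setReg x (M.reg y)
  | .load x a i => M.setReg x (M.arr a (M.reg i))
  | .store a i x => M.setArr a (M.reg i) (M.reg x)
  | .numZero a i => M.setNum a (M.reg i) 0
  | .numOne a i => M.setNum a (M.reg i) 1
  | .numOp o a i b j d k =>
      M.setNum a (M.reg i) (o.apply (M.num b (M.reg j)) (M.num d (M.reg k)))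

/-- The cost of an instruction: one, plus the weights `w` of the field elements that it reads and
computes. -/
def Instr.cost (w : K → ℕ) (M : Memory K) : Instr → ℕ
  | .numOp o _ _ b j d k =>
      1 + w (M.num b (M.reg j)) + w (M.num d (M.reg k)) +
        w (o.apply (M.num b (M.reg j)) (M.num d (M.reg k)))
  | _ => 1

def Test.Holds (M : Memory K) : Test → Prop
  | .lt x y => M.reg x < M.reg y
  | .numLe a i b j => M.num a (M.reg i) ≤ M.num b (M.reg j)

def Test.cost (w : K → ℕ) (M : Memory K) : Test → ℕ
  | .lt _ _ => 1
  | .numLe a i b j => 1 + w (M.num a (M.reg i)) + w (M.num b (M.reg j))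

/-- `Exec w P M k M'`: started in the memory `M`, the program `P` halts in the memory `M'`, at
total cost `k`. -/
inductive Exec (w : K → ℕ) : Prog → Memory K → ℕ → Memory K → Prop
  | skip (M : Memory K) : Exec w .skip M 0 M
  | instr (c : Instr) (M : Memory K) : Exec w (.instr c) M (c.cost w M) (c.run M)
  | seq {P Q : Prog} {M₁ M₂ M₃ : Memory K} {k l : ℕ} :
      Exec w P M₁ k M₂ → Exec w Q M₂ l M₃ → Exec w (.seq P Q) M₁ (k + l) M₃
  | iteTrue {b : Test} {P Q : Prog} {M M' : Memory K} {k : ℕ} :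
      b.Holds M → Exec w P M k M' → Exec w (.ite b P Q) M (b.cost w M + k) M'
  | iteFalse {b : Test} {P Q : Prog} {M M' : Memory K} {k : ℕ} :
      ¬ b.Holds M → Exec w Q M k M' → Exec w (.ite b P Q) M (b.cost w M + k) M'
  | loopTrue {b : Test} {P : Prog} {M₁ M₂ M₃ : Memory K} {k l : ℕ} :
      b.Holds M₁ → Exec w P M₁ k M₂ → Exec w (.loop b P) M₂ l M₃ →
        Exec w (.loop b P) M₁ (b.cost w M₁ + k + l) M₃
  | loopFalse {b : Test} {P : Prog} {M : Memory K} :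
      ¬ b.Holds M → Exec w (.loop b P) M (b.cost w M) M

end Semantics

/-- Unit cost: every arithmetic operation counts as one step. -/
def unitCost : ℝ → ℕ := fun _ => 0

/-- The bit length of a rational number, the number of binary digits of its numerator and its
denominator in lowest terms. With this weight, `Exec` counts bit cost. -/
def bitLength (q : ℚ) : ℕ := Nat.size q.num.natAbs + Nat.size q.den

end Ram

namespace FlowNetwork

/-- The array with the entries of `g`, followed by zeros. -/
def toArray {α : Type*} [Zero α] {m : ℕ} (g : Fin m → α) (i : ℕ) : α :=
  if h : i < m then g ⟨i, h⟩ else 0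

/-- The memory in which a program starts: registers `0, 1, 2, 3` hold the number of vertices, the
number of edges, the source and the sink, the natural-number arrays `0, 1` hold the tails and the
heads of the edges, the number arrays `0, 1` hold the capacities `c` and the shares `p`; all the
rest is zero. -/
def inputMemory {K : Type*} [Zero K] {n m : ℕ} (N : FlowNetwork (Fin n) (Fin m))
    (c p : Fin m → K) : Ram.Memory K where
  reg
    | 0 => n
    | 1 => m
    | 2 => N.s
    | 3 => N.t
    | _ => 0
  arr
    | 0 => toArray fun e => (N.src e : ℕ)
    | 1 => toArray fun e => (N.tgt e : ℕ)
    | _ => fun _ => 0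
  num
    | 0 => toArray c
    | 1 => toArray p
    | _ => fun _ => 0

/-- `answer`, `δ` and `π` solve the decision problem for the share vector `p`: the answer is `1` if
`p` is in the Owen set and `0` otherwise, and in the first case `(δ, π)` is an optimal dual solution
with `π t = 0` from which `p` arises. -/
def Decides {n m : ℕ} (N : FlowNetwork (Fin n) (Fin m)) (p : Fin m → ℝ)
    (answer : ℕ) (δ : Fin m → ℝ) (π : Fin n → ℝ) : Prop :=
  (p ∈ N.owenSet ∧ answer = 1 ∧ N.DualOptimal δ π ∧ (∀ e, p e = N.c e * δ e) ∧ π N.t = 0) ∨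
    (p ∉ N.owenSet ∧ answer = 0)

end FlowNetwork

set_option linter.unusedSectionVars false

namespace FlowNetwork

variable {V E : Type*} [Fintype E] [DecidableEq V] (N : FlowNetwork V E)

/-! ### Cut sums and weak duality -/

/-! Weak duality suffices throughout. Pairing a flow with a potential gives `DualFeasible.worth_le`.
Since an imputation sums to the worth, any feasible `(δ, π)` with `p = c * δ` is automatically
optimal, so membership in the Owen set only asks for feasible potentials.

For positive capacities `p` determines `δ`. Comparing with a maximum flow gives complementary
slackness: `δ` vanishes on unsaturated edges, and potentials drop by exactly `δ` along edges that
carry flow. Hence potentials are monotone along residual walks, constant on residual components, and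
forced across reversed essential edges: every value fixed by the loop is the only possible one. The
loop cannot get stuck if every node meets an essential edge. An inessential edge carrying flow lies
inside a component (`node_eq_of_not_essential`), so if no arc could be picked, no flow would leave
the free vertices, and by conservation none would enter. An essential edge at a free node would then
lie on a cycle of flow-carrying edges among the free vertices, whose reversal is residual; but the
ends of an essential edge lie in different components (`Essential.node_ne`).

For the polynomial bound, Bellman–Ford computes distances to `t` capped at `1`; the answer is yes
exactly if the source ends at `1` or more. In-place relaxation is squeezed between all admissible
potentials and simultaneous relaxation (`Between`), and `n` rounds make the result respect all
edges. The program is verified once over an ordered field embedded in `ℝ`, with abstract weights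
(`runs_decisionProg`). In the rational case the cap and a common denominator bound the size of all
numbers, independently of the number of rounds. -/

/-- Summation by parts. Potentials as `y` yield duality, indicators of vertex sets yield cut
arguments. -/
theorem sum_mul_netOut [Fintype V] (y : V → ℝ) (h : E → ℝ) :
    ∑ v, y v * N.netOut h v = ∑ e, h e * (y (N.src e) - y (N.tgt e)) := by
  have key (g : E → V) : ∑ v, y v * ∑ e with g e = v, h e = ∑ e, h e * y (g e) := by
    simp_rw [Finset.sum_filter, Finset.mul_sum]
    rw [Finset.sum_comm]
    refine Finset.sum_congr rfl fun e _ => ?_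
    simp [mul_comm]
  simp only [netOut, mul_sub, Finset.sum_sub_distrib, key]

theorem netOut_add (g h : E → ℝ) (v : V) :
    N.netOut (g + h) v = N.netOut g v + N.netOut h v := by
  simp only [netOut, Pi.add_apply, Finset.sum_add_distrib]; ring

theorem netOut_smul (r : ℝ) (h : E → ℝ) (v : V) :
    N.netOut (r • h) v = r * N.netOut h v := by
  simp only [netOut, Pi.smul_apply, smul_eq_mul, ← Finset.mul_sum]; ring

theorem netOut_sub (g h : E → ℝ) (v : V) :
    N.netOut (g - h) v = N.netOut g v - N.netOut h v := by
  simp only [netOut, Pi.sub_apply, Finset.sum_sub_distrib]; ring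

theorem netOut_single [DecidableEq E] (e : E) (r : ℝ) (v : V) : N.netOut (Pi.single e r) v =
    (if v = N.src e then r else 0) - if v = N.tgt e then r else 0 := by
  simp [netOut, Pi.single_apply, eq_comm]

theorem isFlow_zero : N.IsFlow 0 :=
  ⟨fun e => ⟨le_rfl, N.c_nonneg e⟩, fun v _ _ => by simp [netOut]⟩

theorem value_zero : N.value 0 = 0 := by simp [value, netOut]

variable {N}

theorem IsMaxFlow.value_nonneg {f : E → ℝ} (hf : N.IsMaxFlow f) : 0 ≤ N.value f := by
  simpa [value_zero] using hf.2 0 N.isFlow_zero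

theorem IsMaxFlow.worth_eq {f : E → ℝ} (hf : N.IsMaxFlow f) :
    N.worth Finset.univ = N.value f := by
  refine IsGreatest.csSup_eq ⟨⟨f, hf.1, by simp, rfl⟩, ?_⟩
  rintro x ⟨g, hg, -, rfl⟩
  exact hf.2 g hg

theorem IsFlow.netOut_t [Fintype V] {f : E → ℝ} (hf : N.IsFlow f) :
    N.netOut f N.t = -N.value f := by
  have h := N.sum_mul_netOut (fun _ => 1) f
  simp only [one_mul, sub_self, mul_zero, Finset.sum_const_zero] at h
  rw [Finset.sum_eq_add N.s N.t N.s_ne_t (fun v _ hv => hf.2 v hv.1 hv.2) (by simp) (by simp)] at h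
  rw [value]; linarith

theorem IsFlow.value_mul [Fintype V] {f : E → ℝ} (hf : N.IsFlow f) (π : V → ℝ) :
    N.value f * (π N.s - π N.t) = ∑ e, f e * (π (N.src e) - π (N.tgt e)) := by
  rw [← sum_mul_netOut,
    Finset.sum_eq_add N.s N.t N.s_ne_t (fun v _ hv => by simp [hf.2 v hv.1 hv.2]) (by simp)
      (by simp), hf.netOut_t, ← value]
  ring

theorem DualFeasible.sum_mul_le {δ : E → ℝ} {π : V → ℝ} (h : N.DualFeasible δ π) {f : E → ℝ}
    (hf : N.IsFlow f) : ∑ e, f e * δ e ≤ ∑ e, N.c e * δ e :=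
  Finset.sum_le_sum fun e _ => mul_le_mul_of_nonneg_right (hf.1 e).2 (h.2.2.1 e)

theorem DualFeasible.potential_sum_le {δ : E → ℝ} {π : V → ℝ} (h : N.DualFeasible δ π)
    {f : E → ℝ} (hf : N.IsFlow f) :
    ∑ e, f e * (π (N.src e) - π (N.tgt e)) ≤ ∑ e, f e * δ e :=
  Finset.sum_le_sum fun e _ =>
    mul_le_mul_of_nonneg_left (by linarith [h.1 e]) (hf.1 e).1

theorem DualFeasible.sum_nonneg {δ : E → ℝ} {π : V → ℝ} (h : N.DualFeasible δ π) :
    0 ≤ ∑ e, N.c e * δ e :=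
  Finset.sum_nonneg fun e _ => mul_nonneg (N.c_nonneg e) (h.2.2.1 e)

theorem DualFeasible.value_le [Fintype V] {δ : E → ℝ} {π : V → ℝ} (h : N.DualFeasible δ π)
    {f : E → ℝ} (hf : N.IsFlow f) : N.value f ≤ ∑ e, N.c e * δ e := by
  -- For a negative value the inequality `1 ≤ π s - π t` would work in the wrong direction.
  rcases le_total (N.value f) 0 with h0 | h0
  · exact h0.trans h.sum_nonneg
  · have := hf.value_mul π
    nlinarith [h.sum_mul_le hf, h.potential_sum_le hf, h.2.1]

theorem DualFeasible.worth_le [Fintype V] {δ : E → ℝ} {π : V → ℝ} (h : N.DualFeasible δ π) :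
    N.worth Finset.univ ≤ ∑ e, N.c e * δ e := by
  refine csSup_le ⟨_, 0, N.isFlow_zero, by simp, rfl⟩ ?_
  rintro x ⟨f, hf, -, rfl⟩
  exact h.value_le hf

theorem DualFeasible.dualOptimal [Fintype V] {δ : E → ℝ} {π : V → ℝ} (h : N.DualFeasible δ π)
    {p : E → ℝ} (hp : N.IsImputation p) (hpδ : ∀ e, p e = N.c e * δ e) : N.DualOptimal δ π := by
  refine ⟨h, fun δ' π' h' => ?_⟩
  rw [← Finset.sum_congr rfl fun e _ => hpδ e, hp.2]
  exact h'.worth_le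

/-- Shifting puts the sink at `0`; truncation at `0` restores nonnegativity and respects the edge
constraints because `δ` is nonnegative. -/
theorem DualFeasible.normalize {δ : E → ℝ} {π : V → ℝ} (h : N.DualFeasible δ π) :
    N.DualFeasible δ fun v => max (π v - π N.t) 0 := by
  refine ⟨fun e => ?_, ?_, h.2.2.1, fun v => le_max_right _ _⟩
  · have h1 := h.1 e
    have h2 := h.2.2.1 e
    have : max (π (N.src e) - π N.t) 0 ≤ δ e + max (π (N.tgt e) - π N.t) 0 := by
      refine max_le ?_ (by positivity)
      linarith [le_max_left (π (N.tgt e) - π N.t) 0]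
    linarith
  · have := le_max_left (π N.s - π N.t) 0
    have := h.2.1
    simp only [sub_self, max_self]; linarith

/-! ### Complementary slackness -/

theorem eq_shareLength (hc : ∀ e, 0 < N.c e) {p δ : E → ℝ} (h : ∀ e, p e = N.c e * δ e) :
    δ = N.shareLength p := by
  funext e
  rw [shareLength, h e, mul_div_cancel_left₀ _ (hc e).ne']

theorem mul_shareLength (hc : ∀ e, 0 < N.c e) (p : E → ℝ) (e : E) :
    p e = N.c e * N.shareLength p e := by
  rw [shareLength, mul_div_cancel₀ _ (hc e).ne']

theorem mem_owenSet_iff [Fintype V] (hc : ∀ e, 0 < N.c e) {p : E → ℝ} (hp : N.IsImputation p) :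
    p ∈ N.owenSet ↔ ∃ π, N.DualFeasible (N.shareLength p) π := by
  constructor
  · rintro ⟨δ, π, h, hpδ⟩
    exact ⟨π, eq_shareLength hc hpδ ▸ h.1⟩
  · rintro ⟨π, h⟩
    exact ⟨_, π, h.dualOptimal hp (mul_shareLength hc p), mul_shareLength hc p⟩

/-- The chain value ≤ value · (π s − π t) = ∑ f (π src − π tgt) ≤ ∑ f δ ≤ ∑ c δ = value collapses,
so the last two inequalities are equalities term by term. -/
theorem DualFeasible.slackness [Fintype V] {δ : E → ℝ} {π : V → ℝ} (h : N.DualFeasible δ π)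
    {p : E → ℝ} (hp : N.IsImputation p) (hpδ : ∀ e, p e = N.c e * δ e) {f : E → ℝ}
    (hf : N.IsMaxFlow f) :
    (∀ e, f e < N.c e → δ e = 0) ∧ ∀ e, 0 < f e → π (N.src e) = π (N.tgt e) + δ e := by
  have hsum : ∑ e, N.c e * δ e = N.value f := by
    rw [← Finset.sum_congr rfl fun e _ => hpδ e, hp.2, hf.worth_eq]
  have h1 := h.sum_mul_le hf.1
  have h2 := h.potential_sum_le hf.1
  have h3 : N.value f ≤ N.value f * (π N.s - π N.t) :=
    le_mul_of_one_le_right hf.value_nonneg h.2.1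
  rw [hf.1.value_mul] at h3
  constructor
  · intro e he
    have h4 := (Finset.sum_eq_sum_iff_of_le fun e _ =>
      mul_le_mul_of_nonneg_right (hf.1.1 e).2 (h.2.2.1 e)).1
        (by linarith : ∑ e, f e * δ e = ∑ e, N.c e * δ e) e (Finset.mem_univ e)
    by_contra h5
    exact he.ne (mul_right_cancel₀ h5 h4)
  · intro e he
    have h4 := (Finset.sum_eq_sum_iff_of_le fun e _ =>
      mul_le_mul_of_nonneg_left (by linarith [h.1 e] : π (N.src e) - π (N.tgt e) ≤ δ e)
        (hf.1.1 e).1).1 (by linarith) e (Finset.mem_univ e)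
    have := mul_left_cancel₀ he.ne' h4
    linarith

theorem DualFeasible.eq_zero_of_not_essential [Fintype V] {δ : E → ℝ} {π : V → ℝ}
    (h : N.DualFeasible δ π) {p : E → ℝ} (hp : N.IsImputation p) (hpδ : ∀ e, p e = N.c e * δ e)
    {e : E} (he : ¬ N.Essential e) : p e = 0 := by
  simp only [Essential, not_forall] at he
  obtain ⟨g, hg, hge⟩ := he
  rw [hpδ, (h.slackness hp hpδ hg).1 e (lt_of_le_of_ne (hg.1.1 e).2 hge), mul_zero]

/-- Potentials of an optimal dual solution do not decrease along residual walks. -/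
theorem DualFeasible.le_of_residual [Fintype V] {δ : E → ℝ} {π : V → ℝ}
    (h : N.DualFeasible δ π) {p : E → ℝ} (hp : N.IsImputation p)
    (hpδ : ∀ e, p e = N.c e * δ e) {f : E → ℝ} (hf : N.IsMaxFlow f) {u v : V}
    (huv : Relation.ReflTransGen (N.ResidualAdj f) u v) : π u ≤ π v := by
  have hs := h.slackness hp hpδ hf
  induction huv with
  | refl => exact le_rfl
  | tail _ hbc ih =>
    refine ih.trans ?_
    obtain ⟨⟨e, b⟩, ha, rfl, rfl⟩ := hbc
    rcases ha with ⟨hb, he⟩ | ⟨hb, he⟩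
    · obtain rfl : b = true := hb
      have := h.1 e
      rw [hs.1 e he] at this
      simpa [arcTail, arcHead] using this
    · obtain rfl : b = false := hb
      simpa [arcTail, arcHead, hs.2 e he] using h.2.2.1 e

theorem DualFeasible.eq_of_node_eq [Fintype V] {δ : E → ℝ} {π : V → ℝ}
    (h : N.DualFeasible δ π) {p : E → ℝ} (hp : N.IsImputation p)
    (hpδ : ∀ e, p e = N.c e * δ e) {f : E → ℝ} (hf : N.IsMaxFlow f) {u v : V}
    (huv : N.node f u = N.node f v) : π u = π v := by
  have := Quotient.exact huv
  exact le_antisymm (h.le_of_residual hp hpδ hf this.1) (h.le_of_residual hp hpδ hf this.2)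

/-! ### Stages of the propagation algorithm -/

/-- This is why `PropStep` need not demand the reversed direction: a maximum flow saturates an
essential edge, so only its reversal is residual. -/
theorem Essential.eq_false_of_residual {f : E → ℝ} (hf : N.IsMaxFlow f) {a : E × Bool}
    (he : N.Essential a.1) (ha : a ∈ N.residualArcs f) : a.2 = false ∧ 0 < f a.1 := by
  rcases ha with ha | ha
  · exact absurd (he f hf) ha.2.ne
  · exact ha

/-- The picked arc reverses an edge that carries flow, so slackness makes the update rule an
equation for `π`; constancy on components transfers it to all vertices of the new node. -/
theorem Propagates.potential_eq [Fintype V] {f p : E → ℝ} (hf : N.IsMaxFlow f)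
    (hp : N.IsImputation p) {k : ℕ} {σ : N.PQNode f → Option ℝ} (hσ : N.Propagates f p k σ)
    (hc : ∀ e, 0 < N.c e) {δ : E → ℝ} {π : V → ℝ} (h : N.DualFeasible δ π)
    (hpδ : ∀ e, p e = N.c e * δ e) (ht : π N.t = 0) (v : V) (x : ℝ)
    (hv : σ (N.node f v) = some x) : π v = x := by
  induction hσ generalizing v x with
  | start =>
    rw [startState] at hv
    split_ifs at hv with hvt
    rw [h.eq_of_node_eq hp hpδ hf hvt, ht]
    exact Option.some.inj hv
  | step _ hs ih =>
    classical
    obtain ⟨a, ha, hae, y, hy, -, rfl⟩ := hs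
    by_cases hva : N.node f v = N.node f (N.arcHead a)
    · rw [hva, Function.update_self] at hv
      obtain ⟨hb, hpos⟩ := hae.eq_false_of_residual hf ha.1
      have h1 := (h.slackness hp hpδ hf).2 a.1 hpos
      have h2 := ih _ _ hy
      rw [h.eq_of_node_eq hp hpδ hf hva, ← Option.some.inj hv, ← eq_shareLength hc hpδ, ← h2]
      simpa [arcTail, arcHead, hb] using h1
    · rw [Function.update_of_ne hva] at hv
      exact ih v x hv

theorem Propagates.mem_owenSet_iff [Fintype V] {f p : E → ℝ} (hf : N.IsMaxFlow f)
    (hp : N.IsImputation p) {k : ℕ} {σ : N.PQNode f → Option ℝ} (hσ : N.Propagates f p k σ)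
    (hc : ∀ e, 0 < N.c e) :
    p ∈ N.owenSet ↔ (∀ e, ¬ N.Essential e → p e = 0) ∧
      ∃ π : V → ℝ, (∀ v x, σ (N.node f v) = some x → π v = x) ∧
        N.DualFeasible (N.shareLength p) π := by
  rw [FlowNetwork.mem_owenSet_iff hc hp]
  constructor
  · rintro ⟨π, h⟩
    exact ⟨fun e he => h.eq_zero_of_not_essential hp (mul_shareLength hc p) he, _,
      hσ.potential_eq hf hp hc h.normalize (mul_shareLength hc p) (by simp), h.normalize⟩
  · rintro ⟨-, π, -, h⟩
    exact ⟨π, h⟩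

theorem Propagates.answersYes_iff [Fintype V] {f p : E → ℝ} (hf : N.IsMaxFlow f)
    (hp : N.IsImputation p) {k : ℕ} {σ : N.PQNode f → Option ℝ} (hσ : N.Propagates f p k σ)
    (hc : ∀ e, 0 < N.c e) (hfin : N.Finished f σ) : p ∈ N.owenSet ↔ N.AnswersYes f p σ := by
  rw [hσ.mem_owenSet_iff hf hp hc]
  refine and_congr_right fun _ => exists_congr fun π => and_congr_left fun _ => ?_
  refine forall_congr' fun v => ?_
  obtain ⟨x, hx⟩ := Option.isSome_iff_exists.1 (hfin (N.node f v))
  rw [hx]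
  simp [eq_comm]

theorem Propagates.ncard_eq [Finite V] {f p : E → ℝ} {k : ℕ} {σ : N.PQNode f → Option ℝ}
    (hσ : N.Propagates f p k σ) : {X | (σ X).isSome}.ncard = k + 1 := by
  have : Finite (N.PQNode f) := inferInstanceAs (Finite (Quotient _))
  classical
  induction hσ with
  | start =>
    rw [Set.ncard_eq_one]
    refine ⟨N.node f N.t, Set.ext fun X => ?_⟩
    by_cases hX : X = N.node f N.t <;> simp [startState, hX]
  | @step k σ σ' _ hs ih =>
    obtain ⟨a, -, -, x, -, hnone, rfl⟩ := hs
    rw [← ih, ← Set.ncard_insert_of_notMem (a := N.node f (N.arcHead a)) (by simp [hnone])]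
    congr 1
    ext X
    by_cases hX : X = N.node f (N.arcHead a) <;> simp [Function.update_apply, hX]

theorem Propagates.lt_card [Finite V] {f p : E → ℝ} {k : ℕ} {σ : N.PQNode f → Option ℝ}
    (hσ : N.Propagates f p k σ) : k < Nat.card (N.PQNode f) := by
  have : Finite (N.PQNode f) := inferInstanceAs (Finite (Quotient _))
  rw [← Nat.succ_le_iff, Nat.succ_eq_add_one, ← hσ.ncard_eq]
  exact Set.ncard_le_card _

theorem Propagates.start_fixed {f p : E → ℝ} {k : ℕ} {σ : N.PQNode f → Option ℝ}
    (hσ : N.Propagates f p k σ) : (σ (N.node f N.t)).isSome := by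
  induction hσ with
  | start => simp [startState]
  | step _ hs ih =>
    obtain ⟨a, -, -, x, -, -, rfl⟩ := hs
    classical
    rw [Function.update_apply]
    split_ifs <;> simp [ih]

/-! ### Essential edges and the components of the residual graph -/

/-- If no net flow leaves a set of vertices, and on every edge across its boundary the net flow in
the outward direction is nonpositive, then it vanishes on all those edges. -/
theorem eq_zero_of_crossing [Fintype V] {h : E → ℝ} {R : Set V}
    (hR : ∀ v ∈ R, 0 ≤ N.netOut h v)
    (hout : ∀ e, N.src e ∈ R → N.tgt e ∉ R → h e ≤ 0)
    (hin : ∀ e, N.src e ∉ R → N.tgt e ∈ R → 0 ≤ h e) {e : E}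
    (he : ¬ (N.src e ∈ R ↔ N.tgt e ∈ R)) : h e = 0 := by
  classical
  have hsum := N.sum_mul_netOut (R.indicator 1) h
  have hle : ∀ e ∈ (Finset.univ : Finset E),
      h e * (R.indicator 1 (N.src e) - R.indicator 1 (N.tgt e)) ≤ 0 := by
    intro e _
    by_cases h1 : N.src e ∈ R <;> by_cases h2 : N.tgt e ∈ R <;> simp [h1, h2]
    · exact hout e h1 h2
    · exact hin e h1 h2
  have hge : 0 ≤ ∑ v, R.indicator 1 v * N.netOut h v := by
    refine Finset.sum_nonneg fun v _ => ?_
    by_cases hv : v ∈ R <;> simp [hv]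
    exact hR v hv
  -- The sum over vertices is nonnegative, the equal sum over edges has nonpositive terms; hence
  -- every term vanishes.
  have h0 := (Finset.sum_eq_zero_iff_of_nonpos hle).1
    (le_antisymm (Finset.sum_nonpos hle) (hsum ▸ hge)) e (Finset.mem_univ e)
  by_cases h1 : N.src e ∈ R <;> by_cases h2 : N.tgt e ∈ R <;> simp_all

theorem IsMaxFlow.netOut_eq [Fintype V] {f g : E → ℝ} (hf : N.IsMaxFlow f)
    (hg : N.IsMaxFlow g) (v : V) : N.netOut g v = N.netOut f v := by
  have h : N.value g = N.value f := le_antisymm (hf.2 g hg.1) (hg.2 f hf.1)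
  by_cases hs : v = N.s
  · rw [hs]; exact h
  by_cases ht : v = N.t
  · rw [ht, hf.1.netOut_t, hg.1.netOut_t, h]
  · rw [hf.1.2 v hs ht, hg.1.2 v hs ht]

theorem residualAdj_of_lt {f : E → ℝ} {e : E} (h : f e < N.c e) :
    N.ResidualAdj f (N.src e) (N.tgt e) := ⟨(e, true), .inl ⟨rfl, h⟩, rfl, rfl⟩

theorem residualAdj_of_pos {f : E → ℝ} {e : E} (h : 0 < f e) :
    N.ResidualAdj f (N.tgt e) (N.src e) := ⟨(e, false), .inr ⟨rfl, h⟩, rfl, rfl⟩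

/-- If `e` is saturated by `f`, take a maximum flow `g` that does not saturate it and let `R` be the
residual reach of its tail. No residual arc leaves `R`, which fixes the sign of the circulation `g -
f` on the boundary. If the head were outside `R`, then `g e = f e`, a contradiction. -/
theorem node_eq_of_not_essential [Fintype V] {f : E → ℝ} (hf : N.IsMaxFlow f) {e : E}
    (he : ¬ N.Essential e) (hpos : 0 < f e) : N.node f (N.src e) = N.node f (N.tgt e) := by
  refine Quotient.sound ⟨?_, .single (residualAdj_of_pos hpos)⟩
  simp only [Essential, not_forall] at he
  obtain ⟨g, hg, hge⟩ := he
  by_cases hfe : f e < N.c e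
  · exact .single (residualAdj_of_lt hfe)
  by_contra hR
  have h0 := eq_zero_of_crossing (N := N) (h := g - f) (e := e)
    (R := {v | Relation.ReflTransGen (N.ResidualAdj f) (N.src e) v})
    (fun v _ => by rw [netOut_sub, hf.netOut_eq hg, sub_self])
    (fun a h1 h2 => by
      by_contra h3
      simp only [Pi.sub_apply, not_le] at h3
      exact h2 (.tail h1 (residualAdj_of_lt (by linarith [(hg.1.1 a).2]))))
    (fun a h1 h2 => by
      by_contra h3
      simp only [Pi.sub_apply, not_le] at h3
      exact h1 (.tail h2 (residualAdj_of_pos (by linarith [(hg.1.1 a).1]))))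
    (fun h => hR (h.1 .refl))
  simp only [Pi.sub_apply] at h0
  exact hge (le_antisymm (hg.1.1 e).2 (by linarith))

/-- A residual walk from `u` to `v` carries a unit of additional flow. -/
theorem exists_augmentation {f : E → ℝ} {u v : V}
    (huv : Relation.ReflTransGen (N.ResidualAdj f) u v) :
    ∃ h : E → ℝ, (∀ e, 0 < h e → f e < N.c e) ∧ (∀ e, h e < 0 → 0 < f e) ∧
      ∀ x, N.netOut h x = (if x = u then 1 else 0) - if x = v then 1 else 0 := by
  classical
  induction huv with
  | refl => exact ⟨0, by simp, by simp, by simp [netOut]⟩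
  | @tail b d _ hbc ih =>
    obtain ⟨h, h1, h2, h3⟩ := ih
    obtain ⟨⟨e, b⟩, ha, rfl, rfl⟩ := hbc
    rcases ha with ⟨hb, he⟩ | ⟨hb, he⟩
    · obtain rfl : b = true := hb
      refine ⟨h + Pi.single e 1, fun a ha => ?_, fun a ha => ?_, fun x => ?_⟩
      · by_cases hae : a = e
        · exact hae ▸ he
        · exact h1 a (by simpa [hae] using ha)
      · by_cases hae : a = e
        · subst hae
          exact h2 a (by simp at ha; linarith)
        · exact h2 a (by simpa [hae] using ha)
      · rw [netOut_add, h3, netOut_single]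
        change ((if x = u then (1 : ℝ) else 0) - if x = N.src e then 1 else 0) + _ =
          (if x = u then (1 : ℝ) else 0) - if x = N.tgt e then 1 else 0
        ring
    · obtain rfl : b = false := hb
      refine ⟨h - Pi.single e 1, fun a ha => ?_, fun a ha => ?_, fun x => ?_⟩
      · by_cases hae : a = e
        · subst hae
          exact h1 a (by simp at ha; linarith)
        · exact h1 a (by simpa [hae] using ha)
      · by_cases hae : a = e
        · exact hae ▸ he
        · exact h2 a (by simpa [hae] using ha)
      · rw [netOut_sub, h3, netOut_single]
        change ((if x = u then (1 : ℝ) else 0) - if x = N.tgt e then 1 else 0) - _ =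
          (if x = u then (1 : ℝ) else 0) - if x = N.src e then 1 else 0
        ring

/-- A circulation leaves the value unchanged, and the finitely many capacity constraints survive a
small enough multiple of it. -/
theorem IsMaxFlow.exists_push {f h : E → ℝ} (hf : N.IsMaxFlow f)
    (hpos : ∀ e, 0 < h e → f e < N.c e) (hneg : ∀ e, h e < 0 → 0 < f e)
    (hcirc : ∀ v, N.netOut h v = 0) : ∃ ε : ℝ, 0 < ε ∧ N.IsMaxFlow (f + ε • h) := by
  have hev : ∀ e, ∀ᶠ ε : ℝ in nhdsWithin 0 (Set.Ioi 0),
      0 ≤ f e + ε * h e ∧ f e + ε * h e ≤ N.c e := by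
    intro e
    have hlim : Filter.Tendsto (fun ε : ℝ => f e + ε * h e) (nhdsWithin 0 (Set.Ioi 0))
        (nhds (f e)) := by
      have : Filter.Tendsto (fun ε : ℝ => f e + ε * h e) (nhds 0) (nhds (f e + 0 * h e)) :=
        (Continuous.tendsto (by fun_prop) 0)
      simpa using this.mono_left nhdsWithin_le_nhds
    have hev0 : ∀ᶠ ε : ℝ in nhdsWithin 0 (Set.Ioi 0), 0 < ε := eventually_mem_nhdsWithin
    have hfe := hf.1.1 e
    rcases lt_trichotomy (h e) 0 with h0 | h0 | h0
    · filter_upwards [hlim.eventually (lt_mem_nhds (hneg e h0)), hev0] with ε h1 h2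
      exact ⟨h1.le, by nlinarith⟩
    · exact .of_forall fun ε => by simpa [h0] using hfe
    · filter_upwards [hlim.eventually (gt_mem_nhds (hpos e h0)), hev0] with ε h1 h2
      exact ⟨by nlinarith, h1.le⟩
  obtain ⟨ε, h1, h2⟩ := ((Filter.eventually_all.2 hev).and eventually_mem_nhdsWithin).exists
  have hnet (v : V) : N.netOut (f + ε • h) v = N.netOut f v := by
    rw [netOut_add, netOut_smul, hcirc, mul_zero, add_zero]
  refine ⟨ε, h2, ⟨h1, fun v hs ht => by rw [hnet, hf.1.2 v hs ht]⟩, fun g hg => ?_⟩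
  rw [show N.value (f + ε • h) = N.value f from hnet _]
  exact hf.2 g hg

/-- Otherwise a residual walk from tail to head, closed by the reversal of `e`, is a circulation.
Since `e` is saturated, the walk has no positive amount on `e`, so pushing along the circulation
lowers the flow there and yields a maximum flow that does not saturate `e`. -/
theorem Essential.node_ne {f : E → ℝ} (hf : N.IsMaxFlow f) {e : E} (he : N.Essential e)
    (hc : 0 < N.c e) : N.node f (N.src e) ≠ N.node f (N.tgt e) := by
  intro hnode
  classical
  obtain ⟨h, hpos, hneg, hnet⟩ := exists_augmentation (Quotient.exact hnode).1
  have hfe := he f hf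
  have hhe : h e ≤ 0 := by
    by_contra h0
    exact (hpos e (not_le.1 h0)).ne hfe
  obtain ⟨ε, hε, hmax⟩ := hf.exists_push (h := h - Pi.single e 1)
    (fun a ha => by
      by_cases hae : a = e
      · subst hae
        simp at ha
        linarith
      · exact hpos a (by simpa [hae] using ha))
    (fun a ha => by
      by_cases hae : a = e
      · subst hae
        rwa [hfe]
      · exact hneg a (by simpa [hae] using ha))
    (fun v => by rw [netOut_sub, hnet, netOut_single, sub_self])
  have := he _ hmax
  simp only [Pi.add_apply, Pi.smul_apply, Pi.sub_apply, Pi.single_eq_same, smul_eq_mul] at this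
  nlinarith

theorem Propagates.exists_propStep [Fintype V] {f p : E → ℝ} (hf : N.IsMaxFlow f) {k : ℕ}
    {σ : N.PQNode f → Option ℝ} (hσ : N.Propagates f p k σ) (hc : ∀ e, 0 < N.c e)
    (hmeet : ∀ X : N.PQNode f, ∃ e, N.Essential e ∧
      (N.node f (N.src e) = X ∨ N.node f (N.tgt e) = X))
    (hfin : ¬ N.Finished f σ) : ∃ σ', N.PropStep f p σ σ' := by
  by_contra hstuck
  -- The free vertices. An essential edge that leaves `U` would allow a further iteration through
  -- its reversal.
  let U : Set V := {v | σ (N.node f v) = none}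
  have htU : N.t ∉ U := fun h => by
    have := hσ.start_fixed
    rw [show σ (N.node f N.t) = none from h] at this
    simp at this
  have hess : ∀ e, N.src e ∈ U → N.tgt e ∉ U → ¬ N.Essential e := by
    intro e h1 h2 he
    obtain ⟨x, hx⟩ := Option.ne_none_iff_exists'.1 h2
    refine hstuck ⟨_, (e, false), ⟨.inr ⟨rfl, ?_⟩, (he.node_ne hf (hc e)).symm⟩, he, x, hx, h1, rfl⟩
    rw [he f hf]
    exact hc e
  have hout : ∀ e, N.src e ∈ U → N.tgt e ∉ U → f e = 0 := by
    intro e h1 h2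
    by_contra h0
    have := node_eq_of_not_essential hf (hess e h1 h2)
      (lt_of_le_of_ne (hf.1.1 e).1 (Ne.symm h0))
    exact h2 (show σ (N.node f (N.tgt e)) = none from this ▸ h1)
  have hnet : ∀ v ∈ U, 0 ≤ N.netOut f v := by
    intro v hv
    by_cases hs : v = N.s
    · rw [hs]
      exact hf.value_nonneg
    · exact (hf.1.2 v hs fun ht => htU (ht ▸ hv)).ge
  have hcross {e : E} (he : ¬ (N.src e ∈ U ↔ N.tgt e ∈ U)) : f e = 0 :=
    eq_zero_of_crossing hnet (fun e h1 h2 => (hout e h1 h2).le) (fun e _ _ => (hf.1.1 e).1) he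
  obtain ⟨X, hX⟩ := not_forall.1 hfin
  obtain ⟨e, he, heX⟩ := hmeet X
  have hpos : 0 < f e := by
    rw [he f hf]
    exact hc e
  have hX' : σ X = none := by simpa using hX
  have hiff : N.src e ∈ U ↔ N.tgt e ∈ U := by
    by_contra h
    exact hpos.ne' (hcross h)
  have hsrc : N.src e ∈ U := by
    rcases heX with rfl | rfl
    · exact hX'
    · exact hiff.2 hX'
  -- `R` is reached from the head of `e` along edges with positive flow. It stays inside `U`, and no
  -- flow leaves it, so none enters; hence it contains the tail of `e`, and `e` closes a cycle of
  -- positive flow.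
  let R : Set V := {v | Relation.ReflTransGen (fun u w => ∃ a, 0 < f a ∧ N.src a = u ∧ N.tgt a = w)
    (N.tgt e) v}
  have hRU : R ⊆ U := by
    intro v hv
    induction hv with
    | refl => exact hiff.1 hsrc
    | tail _ hbc ih =>
      obtain ⟨a, ha, rfl, rfl⟩ := hbc
      by_contra h
      exact ha.ne' (hcross fun h' => h (h'.1 ih))
  have hRe : N.src e ∈ R := by
    by_contra h
    exact hpos.ne' (eq_zero_of_crossing (R := R) (fun v hv => hnet v (hRU hv))
      (fun a h1 h2 => not_lt.1 fun ha => h2 (.tail h1 ⟨a, ha, rfl, rfl⟩))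
      (fun a _ _ => (hf.1.1 a).1) fun h' => h (h'.2 .refl))
  refine he.node_ne hf (hc e) (Quotient.sound ⟨?_, .single (residualAdj_of_pos hpos)⟩)
  refine Relation.ReflTransGen.mono ?_ _ _ (Relation.reflTransGen_swap.2 hRe)
  rintro u w ⟨a, ha, rfl, rfl⟩
  exact residualAdj_of_pos ha

end FlowNetwork

namespace FlowNetwork

/-! ### Capped distances to the sink by rounds of edge relaxations -/

section Relaxation

variable {V E : Type*} [Fintype E] [DecidableEq V] (N : FlowNetwork V E)

/-- The potentials before the first round of relaxations. -/
def startPotential (v : V) : ℝ := if v = N.t then 0 else 1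

/-- One simultaneous relaxation of all edges. -/
noncomputable def relaxRound (δ : E → ℝ) (d : V → ℝ) (v : V) : ℝ :=
  (Finset.univ : Finset (Option E)).inf' Finset.univ_nonempty fun o =>
    o.elim (d v) fun e => if N.src e = v then d (N.tgt e) + δ e else d v

/-- The potentials after `k` simultaneous relaxations of all edges. -/
noncomputable def roundPotential (δ : E → ℝ) (k : ℕ) : V → ℝ :=
  (N.relaxRound δ)^[k] N.startPotential

/-- No edge is longer than its length `δ` allows. -/
def Respects (δ : E → ℝ) (y : V → ℝ) : Prop := ∀ e, y (N.src e) ≤ y (N.tgt e) + δ e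

variable {N} {δ : E → ℝ}

theorem roundPotential_succ (k : ℕ) :
    N.roundPotential δ (k + 1) = N.relaxRound δ (N.roundPotential δ k) :=
  Function.iterate_succ_apply' _ _ _

theorem roundPotential_succ_le (k : ℕ) (v : V) :
    N.roundPotential δ (k + 1) v ≤ N.roundPotential δ k v := by
  rw [roundPotential_succ]
  exact Finset.inf'_le _ (Finset.mem_univ none)

theorem roundPotential_src_le (k : ℕ) (e : E) :
    N.roundPotential δ (k + 1) (N.src e) ≤ N.roundPotential δ k (N.tgt e) + δ e := by
  rw [roundPotential_succ]
  refine (Finset.inf'_le _ (Finset.mem_univ (some e))).trans ?_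
  simp

theorem roundPotential_antitone (v : V) : Antitone fun k => N.roundPotential δ k v :=
  antitone_nat_of_succ_le fun k => roundPotential_succ_le k v

theorem exists_edge_of_roundPotential_lt {k : ℕ} {v : V}
    (h : N.roundPotential δ (k + 1) v < N.roundPotential δ k v) :
    ∃ e, N.src e = v ∧ N.roundPotential δ (k + 1) v = N.roundPotential δ k (N.tgt e) + δ e := by
  obtain ⟨o, -, ho⟩ := Finset.exists_mem_eq_inf' Finset.univ_nonempty fun o : Option E =>
    o.elim (N.roundPotential δ k v) fun e =>
      if N.src e = v then N.roundPotential δ k (N.tgt e) + δ e else N.roundPotential δ k v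
  rw [← relaxRound, ← roundPotential_succ] at ho
  rcases o with _ | e
  · exact absurd ho h.ne
  · by_cases he : N.src e = v
    · exact ⟨e, he, by simpa [he] using ho⟩
    · exact absurd (by simpa [he] using ho) h.ne

/-- A potential that still improves in round `k + 1` is witnessed by a walk through `k + 1`
distinct vertices. -/
theorem exists_card_eq_of_roundPotential_lt (hδ : ∀ e, 0 ≤ δ e) {k : ℕ} {v : V}
    (h : N.roundPotential δ (k + 1) v < N.roundPotential δ k v) :
    ∃ S : Finset V, S.card = k + 1 ∧
      ∀ u ∈ S, N.roundPotential δ (k + 1) u ≤ N.roundPotential δ (k + 1) v := by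
  induction k generalizing v with
  | zero => exact ⟨{v}, by simp⟩
  | succ k ih =>
    obtain ⟨e, rfl, he⟩ := exists_edge_of_roundPotential_lt h
    -- Had the head not improved in the previous round, the tail could have reached its new value
    -- one round earlier.
    have hlt : N.roundPotential δ (k + 1) (N.tgt e) < N.roundPotential δ k (N.tgt e) := by
      by_contra hge
      have := roundPotential_src_le (N := N) (δ := δ) k e
      linarith
    obtain ⟨S, hS, hSle⟩ := ih hlt
    have hle (u : V) (hu : u ∈ S) :
        N.roundPotential δ (k + 1) u ≤ N.roundPotential δ (k + 1 + 1) (N.src e) := by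
      linarith [hSle u hu, hδ e]
    refine ⟨insert (N.src e) S, ?_, ?_⟩
    · rw [Finset.card_insert_of_notMem fun hmem => absurd (hle _ hmem) (not_le.2 h), hS]
    · intro u hu
      rcases Finset.mem_insert.1 hu with rfl | hu
      · exact le_rfl
      · exact (roundPotential_succ_le _ u).trans (hle u hu)

/-- A violated edge means an improvement in the next round, which would require more distinct
vertices than there are. -/
theorem respects_roundPotential_card [Fintype V] (hδ : ∀ e, 0 ≤ δ e) :
    N.Respects δ (N.roundPotential δ (Fintype.card V)) := by
  intro e
  refine le_trans ?_ (roundPotential_src_le _ e)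
  by_contra h
  obtain ⟨S, hS, -⟩ := exists_card_eq_of_roundPotential_lt hδ (not_le.1 h)
  have := S.card_le_univ
  omega

/-- `d` lies between all potentials that respect `δ` and the potentials after `k` rounds. -/
def Between (N : FlowNetwork V E) (δ : E → ℝ) (k : ℕ) (d : V → ℝ) : Prop :=
  (∀ y, (∀ v, y v ≤ N.startPotential v) → N.Respects δ y → ∀ v, y v ≤ d v) ∧
    ∀ v, d v ≤ N.roundPotential δ k v

theorem Between.nonneg {k : ℕ} {d : V → ℝ} (h : N.Between δ k d) (hδ : ∀ e, 0 ≤ δ e) (v : V) :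
    0 ≤ d v := by
  refine h.1 (fun _ => 0) (fun v => ?_) (fun e => by simpa using hδ e) v
  rw [startPotential]
  split_ifs <;> norm_num

theorem Between.le_start {k : ℕ} {d : V → ℝ} (h : N.Between δ k d) (v : V) :
    d v ≤ N.startPotential v :=
  (h.2 v).trans (roundPotential_antitone v (Nat.zero_le k))

theorem Between.le_one {k : ℕ} {d : V → ℝ} (h : N.Between δ k d) (v : V) : d v ≤ 1 := by
  refine (h.le_start v).trans ?_
  rw [startPotential]
  split_ifs <;> norm_num

theorem Between.eq_zero {k : ℕ} {d : V → ℝ} (h : N.Between δ k d) (hδ : ∀ e, 0 ≤ δ e) :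
    d N.t = 0 :=
  le_antisymm (by simpa [startPotential] using h.le_start N.t) (h.nonneg hδ _)

/-- After this many rounds the simultaneous potentials respect `δ` themselves, so both bounds in
`Between` coincide. -/
theorem Between.respects [Fintype V] {d : V → ℝ} (h : N.Between δ (Fintype.card V) d)
    (hδ : ∀ e, 0 ≤ δ e) : N.Respects δ d := by
  have heq : d = N.roundPotential δ (Fintype.card V) := funext fun v => le_antisymm (h.2 v)
    (h.1 _ (fun v => roundPotential_antitone v (Nat.zero_le _))
      (respects_roundPotential_card hδ) v)
  exact heq ▸ respects_roundPotential_card hδ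

theorem between_start : N.Between δ 0 N.startPotential := ⟨fun _ hy _ => hy, fun _ => le_rfl⟩

/-- Relaxing an edge in place keeps the potentials above all those that respect `δ`. -/
theorem Between.relax {k : ℕ} {d : V → ℝ} (h : N.Between δ k d) (e : E) :
    N.Between δ k (Function.update d (N.src e) (min (d (N.src e)) (d (N.tgt e) + δ e))) := by
  refine ⟨fun y hy hyδ v => ?_, fun v => ?_⟩
  · by_cases hv : v = N.src e
    · subst hv
      rw [Function.update_self]
      exact le_min (h.1 y hy hyδ _)
        ((hyδ e).trans (by linarith [h.1 y hy hyδ (N.tgt e)]))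
    · rw [Function.update_of_ne hv]
      exact h.1 y hy hyδ v
  · by_cases hv : v = N.src e
    · subst hv
      rw [Function.update_self]
      exact (min_le_left _ _).trans (h.2 _)
    · rw [Function.update_of_ne hv]
      exact h.2 v

/-- `d` is between, and its upper bound has improved at the tails of the edges in `S`. -/
def Improved (N : FlowNetwork V E) (δ : E → ℝ) (k : ℕ) (S : Set E) (d : V → ℝ) : Prop :=
  N.Between δ k d ∧ ∀ e ∈ S, d (N.src e) ≤ N.roundPotential δ k (N.tgt e) + δ e

/-- The head may already have changed in the current round, but its value is at most the one at the
start of a simultaneous round, so working in place loses nothing. -/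
theorem Improved.relax {k : ℕ} {S : Set E} {d : V → ℝ} (h : N.Improved δ k S d) (e : E) :
    N.Improved δ k (insert e S)
      (Function.update d (N.src e) (min (d (N.src e)) (d (N.tgt e) + δ e))) := by
  refine ⟨h.1.relax e, fun a ha => ?_⟩
  by_cases hv : N.src a = N.src e
  · rw [hv, Function.update_self]
    rcases ha with rfl | ha
    · exact (min_le_right _ _).trans (by linarith [h.1.2 (N.tgt a)])
    · exact (min_le_left _ _).trans (hv ▸ h.2 a ha)
  · rw [Function.update_of_ne hv]
    exact h.2 a (ha.resolve_left fun hae => hv (hae ▸ rfl))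

theorem Improved.between {k : ℕ} {d : V → ℝ} (h : N.Improved δ k Set.univ d) :
    N.Between δ (k + 1) d := by
  refine ⟨h.1.1, fun v => ?_⟩
  rw [roundPotential_succ, relaxRound]
  refine Finset.le_inf' _ _ fun o _ => ?_
  rcases o with _ | e
  · exact h.1.2 v
  · by_cases he : N.src e = v
    · simpa [he] using he ▸ h.2 e trivial
    · simpa [he] using h.1.2 v

end Relaxation

/-! ### Correctness of the decision procedure -/

/-- The lengths that the decision procedure assigns: an edge without capacity receives length `1`,
so that it never constrains potentials that are at most `1`. -/
noncomputable def decisionLength {V E : Type*} (N : FlowNetwork V E) (p : E → ℝ) (e : E) : ℝ :=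
  if N.c e ≤ 0 then 1 else p e / N.c e

theorem decisionLength_nonneg {V E : Type*} (N : FlowNetwork V E) {p : E → ℝ}
    (hp : ∀ e, 0 ≤ p e) (e : E) : 0 ≤ N.decisionLength p e := by
  rw [decisionLength]
  split_ifs with h
  · exact zero_le_one
  · exact div_nonneg (hp e) (N.c_nonneg e)

theorem decides_of_between {n m : ℕ} {N : FlowNetwork (Fin n) (Fin m)} {p : Fin m → ℝ}
    (hp : N.IsImputation p) {d : Fin n → ℝ} (h : N.Between (N.decisionLength p) n d) :
    N.Decides p (if 1 ≤ d N.s then 1 else 0) (N.decisionLength p) d := by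
  have hδ := N.decisionLength_nonneg hp.1
  by_cases hs : 1 ≤ d N.s
  · rw [if_pos hs]
    have hfeas : N.DualFeasible (N.decisionLength p) d := by
      have hr := Between.respects (by rwa [Fintype.card_fin]) hδ
      refine ⟨fun e => ?_, ?_, hδ, h.nonneg hδ⟩
      · have := hr e
        linarith
      · rwa [h.eq_zero hδ, sub_zero]
    -- Equality can fail only at zero capacity. Weak duality bounds the total from below by the
    -- worth, the sum of `p`, which excludes a paid edge without capacity.
    have hle : ∀ e ∈ (Finset.univ : Finset (Fin m)), N.c e * N.decisionLength p e ≤ p e := by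
      intro e _
      rw [decisionLength]
      split_ifs with hc
      · rw [le_antisymm hc (N.c_nonneg e), zero_mul]
        exact hp.1 e
      · rw [mul_div_cancel₀ _ (not_le.1 hc).ne']
    have hpδ (e : Fin m) : p e = N.c e * N.decisionLength p e :=
      ((Finset.sum_eq_sum_iff_of_le hle).1
        (le_antisymm (Finset.sum_le_sum hle) (hp.2 ▸ hfeas.worth_le)) e (Finset.mem_univ e)).symm
    have hopt := hfeas.dualOptimal hp hpδ
    exact .inl ⟨⟨_, _, hopt, hpδ⟩, rfl, hopt, hpδ, h.eq_zero hδ⟩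
  · rw [if_neg hs]
    refine .inr ⟨?_, rfl⟩
    rintro ⟨δ, π, hopt, hpδ⟩
    have hπ := hopt.1.normalize
    set π' : Fin n → ℝ := fun v => max (π v - π N.t) 0 with hπ'
    have hπt : π' N.t = 0 := by simp [hπ']
    -- Capping a normalized optimal solution at `1` gives admissible potentials, which `d`
    -- dominates.
    refine hs (le_trans ?_ (h.1 (fun v => min (π' v) 1) (fun v => ?_) (fun e => ?_) N.s))
    · have := hπ.2.1
      exact le_min (by linarith) le_rfl
    · rw [startPotential]
      split_ifs with hv
      · rw [hv, hπt]
        exact min_le_left _ _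
      · exact min_le_right _ _
    · have h1 := hπ.1 e
      have h2 := hπ.2.2.2 (N.tgt e)
      have h3 := hopt.1.2.2.1 e
      rw [decisionLength]
      split_ifs with hc
      · exact (min_le_right _ _).trans (by linarith [le_min h2 zero_le_one])
      · rw [hpδ, mul_div_cancel_left₀ _ (not_le.1 hc).ne']
        change min (π' (N.src e)) 1 ≤ min (π' (N.tgt e)) 1 + δ e
        rcases le_total (π' (N.tgt e)) 1 with h4 | h4
        · rw [min_eq_left h4]
          exact (min_le_left _ _).trans (by linarith)
        · rw [min_eq_right h4]
          exact (min_le_right _ _).trans (by linarith)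

end FlowNetwork

namespace Ram

/-! ### Reasoning about programs -/

section Runs

variable {K : Type*} [Field K] [LinearOrder K] {w : K → ℕ}

theorem Memory.setReg_reg_self (M : Memory K) (x v : ℕ) : (M.setReg x v).reg x = v :=
  Function.update_self ..

/-- Started in `M`, the program `P` halts at a cost of at most `C` in a memory with the
property `Q`. -/
def Runs (w : K → ℕ) (P : Prog) (C : ℕ) (M : Memory K) (Q : Memory K → Prop) : Prop :=
  ∃ (k : ℕ) (M' : Memory K), k ≤ C ∧ Exec w P M k M' ∧ Q M'

theorem Runs.mono {P : Prog} {C C' : ℕ} {M : Memory K} {Q Q' : Memory K → Prop}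
    (h : Runs w P C M Q) (hC : C ≤ C') (hQ : ∀ M', Q M' → Q' M') : Runs w P C' M Q' := by
  obtain ⟨k, M', hk, hM, hM'⟩ := h
  exact ⟨k, M', hk.trans hC, hM, hQ _ hM'⟩

theorem Runs.skip {M : Memory K} {Q : Memory K → Prop} (hQ : Q M) : Runs w .skip 0 M Q :=
  ⟨0, M, le_rfl, .skip M, hQ⟩

theorem Runs.instr {c : Instr} {C : ℕ} {M : Memory K} {Q : Memory K → Prop}
    (hC : c.cost w M ≤ C) (hQ : Q (c.run M)) : Runs w (.instr c) C M Q :=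
  ⟨_, _, hC, .instr c M, hQ⟩

theorem Runs.seq {P P' : Prog} {C C' : ℕ} {M : Memory K} {Q R : Memory K → Prop}
    (h : Runs w P C M R) (h' : ∀ M', R M' → Runs w P' C' M' Q) :
    Runs w (.seq P P') (C + C') M Q := by
  obtain ⟨k, M₁, hk, hM₁, hR⟩ := h
  obtain ⟨l, M₂, hl, hM₂, hQ⟩ := h' M₁ hR
  exact ⟨_, M₂, add_le_add hk hl, .seq hM₁ hM₂, hQ⟩

theorem Runs.instr_seq {c : Instr} {P : Prog} {C C' : ℕ} {M : Memory K} {Q : Memory K → Prop}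
    (hC : c.cost w M ≤ C) (h : Runs w P C' (c.run M) Q) :
    Runs w (.seq (.instr c) P) (C + C') M Q :=
  Runs.seq (R := (· = c.run M)) (.instr hC rfl) fun _ hM => hM ▸ h

theorem Runs.ite {b : Test} {P P' : Prog} {B C : ℕ} {M : Memory K} {Q : Memory K → Prop}
    (hB : b.cost w M ≤ B) (h : b.Holds M → Runs w P C M Q) (h' : ¬ b.Holds M → Runs w P' C M Q) :
    Runs w (.ite b P P') (B + C) M Q := by
  by_cases hb : b.Holds M
  · obtain ⟨k, M', hk, hM, hQ⟩ := h hb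
    exact ⟨_, M', add_le_add hB hk, .iteTrue hb hM, hQ⟩
  · obtain ⟨k, M', hk, hM, hQ⟩ := h' hb
    exact ⟨_, M', add_le_add hB hk, .iteFalse hb hM, hQ⟩

/-- Run `P` with the values `0, 1, …` in register `x`, as long as they are below the value of
register `b`. -/
def forLoop (x b : ℕ) (P : Prog) : Prog :=
  .seq (.instr (.zero x)) (.loop (.lt x b) (.seq P (.instr (.succ x))))

/-- Each pass pays for the body, one test and one increment; the extra `2` covers the initial
assignment and the failing test. -/
theorem Runs.forLoop {x b n C : ℕ} {P : Prog} {M : Memory K} (I : ℕ → Memory K → Prop)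
    (hreg : ∀ i M, I i M → M.reg x = i ∧ M.reg b = n) (h0 : I 0 (M.setReg x 0))
    (hstep : ∀ i M, i < n → I i M →
      Runs w P C M fun M' => I (i + 1) (M'.setReg x (M'.reg x + 1))) :
    Runs w (forLoop x b P) (2 + n * (C + 2)) M (I n) := by
  -- Here `j` counts the passes still to come.
  have hloop : ∀ j i M, i + j = n → I i M →
      Runs w (.loop (.lt x b) (.seq P (.instr (.succ x)))) (1 + j * (C + 2)) M (I n) := by
    intro j
    induction j with
    | zero =>
      intro i M hi hM
      obtain ⟨h1, h2⟩ := hreg i M hM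
      refine ⟨_, M, ?_, .loopFalse ?_, (by simpa using hi) ▸ hM⟩
      · simp [Test.cost]
      · simp only [Test.Holds, h1, h2]
        omega
    | succ j ih =>
      intro i M hi hM
      obtain ⟨h1, h2⟩ := hreg i M hM
      obtain ⟨k, M₁, hk, hM₁, hI⟩ := Runs.seq (C' := 1) (hstep i M (by omega) hM)
        fun M' hM' => Runs.instr (w := w) (c := .succ x) le_rfl hM'
      obtain ⟨l, M₂, hl, hM₂, hI₂⟩ := ih (i + 1) M₁ (by omega) hI
      refine ⟨_, M₂, ?_, .loopTrue ?_ hM₁ hM₂, hI₂⟩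
      · simp only [Test.cost]
        linarith
      · simp only [Test.Holds, h1, h2]
        omega
  refine (Runs.instr_seq (C := 1) (c := .zero x) le_rfl (hloop n 0 _ (by omega) h0)).mono (by omega)
    fun _ h => h

end Runs

end Ram

namespace FlowNetwork

open Ram

/-! ### The program -/

/-- Store the length of the edge in register `5`. -/
def lengthProg : Prog :=
  .ite (.numLe 0 5 4 8) (.instr (.numOne 2 5)) (.instr (.numOp .div 2 5 1 5 0 5))

/-- Relax the edge in register `5`. -/
def relaxProg : Prog :=
  .seq (.instr (.load 6 0 5)) (.seq (.instr (.load 7 1 5))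
    (.seq (.instr (.numOp .add 5 8 3 7 2 5))
      (.ite (.numLe 3 6 5 8) .skip (.instr (.numOp .add 3 6 5 8 4 8)))))

/-- Compare the potential of the source with `1`. -/
def answerProg : Prog :=
  .seq (.instr (.numOne 6 8))
    (.ite (.numLe 6 8 3 2) (.seq (.instr (.zero 0)) (.instr (.succ 0))) (.instr (.zero 0)))

/-- The decision procedure: capped distances to the sink by rounds of edge relaxations. -/
def decisionProg : Prog :=
  .seq (forLoop 5 1 lengthProg)
    (.seq (forLoop 5 0 (.instr (.numOne 3 5)))
      (.seq (.instr (.numZero 3 3))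
        (.seq (forLoop 4 0 (forLoop 5 1 relaxProg)) answerProg)))

/-! ### Correctness and cost of the program over an arbitrary ordered field -/

section Verification

variable {K : Type*} [Field K] [LinearOrder K] {n m : ℕ} (N : FlowNetwork (Fin n) (Fin m))
  (c p : Fin m → K)

/-- The lengths of the edges, computed in `K`. -/
def fieldLength (e : Fin m) : K := if c e ≤ 0 then 1 else p e / c e

/-- The parts of the memory that the program reads and does not change. -/
structure Layout (M : Memory K) : Prop where
  reg_zero : M.reg 0 = n
  reg_one : M.reg 1 = m
  reg_two : M.reg 2 = N.s
  reg_three : M.reg 3 = N.t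
  reg_eight : M.reg 8 = 0
  arr_zero : ∀ e : Fin m, M.arr 0 e = N.src e
  arr_one : ∀ e : Fin m, M.arr 1 e = N.tgt e
  num_zero : ∀ e : Fin m, M.num 0 e = c e
  num_one : ∀ e : Fin m, M.num 1 e = p e
  num_four : M.num 4 0 = 0

/-- A bound `W` for the weights of the numbers that occur in the computation; the potentials have
the property `H`. -/
structure WeightBound (φ : K →+* ℝ) (w : K → ℕ) (W : ℕ) (H : K → Prop) : Prop where
  zero : H 0
  one : H 1
  add : ∀ x e, H x → φ (x + fieldLength c p e) ≤ 1 → H (x + fieldLength c p e)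
  weight : ∀ x, H x → w x ≤ W
  weight_add : ∀ x e, H x → w (x + fieldLength c p e) ≤ W
  weight_capacity : ∀ e, w (c e) ≤ W
  weight_share : ∀ e, w (p e) ≤ W
  weight_length : ∀ e, w (fieldLength c p e) ≤ W

variable {N c p}

theorem layout_inputMemory : Layout N c p (N.inputMemory c p) := by
  constructor <;> simp [inputMemory, toArray]

theorem Layout.setReg {M : Memory K} (h : Layout N c p M) {x : ℕ} (v : ℕ)
    (hx : x ∉ ({0, 1, 2, 3, 8} : Finset ℕ)) : Layout N c p (M.setReg x v) := by
  simp only [Finset.mem_insert, Finset.mem_singleton, not_or] at hx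
  constructor <;> simp only [Memory.setReg]
  · rw [Function.update_of_ne (Ne.symm hx.1), h.reg_zero]
  · rw [Function.update_of_ne (Ne.symm hx.2.1), h.reg_one]
  · rw [Function.update_of_ne (Ne.symm hx.2.2.1), h.reg_two]
  · rw [Function.update_of_ne (Ne.symm hx.2.2.2.1), h.reg_three]
  · rw [Function.update_of_ne (Ne.symm hx.2.2.2.2), h.reg_eight]
  · exact h.arr_zero
  · exact h.arr_one
  · exact h.num_zero
  · exact h.num_one
  · exact h.num_four

theorem Layout.setNum {M : Memory K} (h : Layout N c p M) {a : ℕ} (i : ℕ) (v : K)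
    (ha : a ∉ ({0, 1, 4} : Finset ℕ)) : Layout N c p (M.setNum a i v) := by
  simp only [Finset.mem_insert, Finset.mem_singleton, not_or] at ha
  constructor <;> simp only [Memory.setNum]
  · exact h.reg_zero
  · exact h.reg_one
  · exact h.reg_two
  · exact h.reg_three
  · exact h.reg_eight
  · exact h.arr_zero
  · exact h.arr_one
  · rw [Function.update_of_ne (Ne.symm ha.1)]
    exact h.num_zero
  · rw [Function.update_of_ne (Ne.symm ha.2.1)]
    exact h.num_one
  · rw [Function.update_of_ne (Ne.symm ha.2.2), h.num_four]

variable {φ : K →+* ℝ} {w : K → ℕ} {W : ℕ} {H : K → Prop}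

theorem map_fieldLength (hφ : StrictMono φ) (hc : ∀ e, N.c e = φ (c e)) (e : Fin m) :
    φ (fieldLength c p e) = N.decisionLength (fun e => φ (p e)) e := by
  have : N.c e ≤ 0 ↔ c e ≤ 0 := by rw [hc, ← map_zero φ, hφ.le_iff_le]
  rw [fieldLength, decisionLength]
  simp only [this]
  split_ifs <;> simp [hc]

/-- The first loop computes the lengths. -/
theorem runs_lengths (hw : WeightBound c p φ w W H) {M : Memory K} (hM : Layout N c p M) :
    Runs w (forLoop 5 1 lengthProg) (2 + m * (2 * (1 + 3 * W) + 2)) M fun M' =>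
      Layout N c p M' ∧ ∀ e : Fin m, M'.num 2 e = fieldLength c p e := by
  refine (Runs.forLoop (fun i M => (Layout N c p M ∧ ∀ e : Fin m, (e : ℕ) < i →
    M.num 2 e = fieldLength c p e) ∧ M.reg 5 = i) ?_ ?_ ?_).mono le_rfl ?_
  · exact fun i M h => ⟨h.2, h.1.1.reg_one⟩
  · exact ⟨⟨hM.setReg 0 (by decide), fun e he => absurd he (Nat.not_lt_zero _)⟩,
      Memory.setReg_reg_self ..⟩
  · rintro i M hi ⟨⟨hM, hlen⟩, h5⟩
    have hcost := hw.weight_capacity ⟨i, hi⟩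
    have hcost' := hw.weight_share ⟨i, hi⟩
    have hcost'' := hw.weight_length ⟨i, hi⟩
    have hcost₀ := hw.weight 0 hw.zero
    have h0 := hM.num_zero ⟨i, hi⟩
    have h1 := hM.num_one ⟨i, hi⟩
    have hres : ∀ y, y = fieldLength c p ⟨i, hi⟩ →
        (Layout N c p ((M.setNum 2 i y).setReg 5 (i + 1)) ∧
          ∀ e : Fin m, (e : ℕ) < i + 1 → ((M.setNum 2 i y).setReg 5 (i + 1)).num 2 e =
            fieldLength c p e) ∧ ((M.setNum 2 i y).setReg 5 (i + 1)).reg 5 = i + 1 := by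
      rintro y rfl
      refine ⟨⟨(hM.setNum _ _ (by decide)).setReg _ (by decide), fun e he => ?_⟩,
        Memory.setReg_reg_self ..⟩
      rcases Nat.lt_succ_iff_lt_or_eq.1 he with he | rfl
      · simpa [Memory.setReg, Memory.setNum, he.ne] using hlen e he
      · simp [Memory.setReg, Memory.setNum]
    refine (Runs.ite (B := 1 + 3 * W) (C := 1 + 3 * W) ?_ (fun hb => ?_) fun hb => ?_).mono
      (by omega) fun _ h => h
    · simp only [Test.cost, h5, hM.reg_eight, hM.num_four, h0]
      omega
    · simp only [Test.Holds, h5, hM.reg_eight, hM.num_four, h0] at hb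
      refine Runs.instr (by simp [Instr.cost]) ?_
      simp only [Instr.run, h5]
      rw [show (M.setNum 2 i 1).reg 5 = i from h5]
      exact hres 1 (by rw [fieldLength, if_pos hb])
    · simp only [Test.Holds, h5, hM.reg_eight, hM.num_four, h0] at hb
      have hdiv : fieldLength c p ⟨i, hi⟩ = p ⟨i, hi⟩ / c ⟨i, hi⟩ := by
        rw [fieldLength, if_neg hb]
      refine Runs.instr ?_ ?_
      · simp only [Instr.cost, h5, h0, h1, Op.apply, ← hdiv]
        omega
      · simp only [Instr.run, h5, h0, h1, Op.apply]
        rw [← hdiv, show (M.setNum 2 i (fieldLength c p ⟨i, hi⟩)).reg 5 = i from h5]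
        exact hres _ rfl
  · rintro M ⟨⟨hM, h⟩, -⟩
    exact ⟨hM, fun e => h e e.2⟩

/-- The second loop and the assignment that follows it compute the initial potentials. -/
theorem runs_start {M : Memory K}
    (hM : Layout N c p M ∧ ∀ e : Fin m, M.num 2 e = fieldLength c p e) :
    Runs w (forLoop 5 0 (.instr (.numOne 3 5))) (2 + n * 3) M fun M' =>
      (Layout N c p M' ∧ ∀ e : Fin m, M'.num 2 e = fieldLength c p e) ∧
        ∀ v : Fin n, M'.num 3 v = 1 := by
  refine (Runs.forLoop (C := 1) (fun i M =>
    ((Layout N c p M ∧ ∀ e : Fin m, M.num 2 e = fieldLength c p e) ∧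
      ∀ v : Fin n, (v : ℕ) < i → M.num 3 v = 1) ∧ M.reg 5 = i) ?_ ?_ ?_).mono le_rfl ?_
  · exact fun i M h => ⟨h.2, h.1.1.1.reg_zero⟩
  · exact ⟨⟨⟨hM.1.setReg 0 (by decide), hM.2⟩, fun e he => absurd he (Nat.not_lt_zero _)⟩,
      Memory.setReg_reg_self ..⟩
  · rintro i M hi ⟨⟨⟨hM, hlen⟩, hone⟩, h5⟩
    refine Runs.instr le_rfl ⟨⟨⟨(hM.setNum _ _ (by decide)).setReg _ (by decide), ?_⟩, ?_⟩, ?_⟩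
    · simpa [Instr.run, Memory.setReg, Memory.setNum] using hlen
    · intro v hv
      rcases Nat.lt_succ_iff_lt_or_eq.1 hv with hv | hv
      · simpa [Instr.run, Memory.setReg, Memory.setNum, h5, hv.ne] using hone v hv
      · simp [Instr.run, Memory.setReg, Memory.setNum, h5, hv]
    · simp [Instr.run, Memory.setReg, Memory.setNum, h5]
  · rintro M ⟨⟨hM, h⟩, -⟩
    exact ⟨hM, fun v => h v v.2⟩

/-- The memory during the rounds of relaxations; the potentials satisfy `D`. -/
structure RelaxState (φ : K →+* ℝ) (H : K → Prop) (N : FlowNetwork (Fin n) (Fin m))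
    (c p : Fin m → K) (D : (Fin n → ℝ) → Prop) (M : Memory K) : Prop where
  layout : Layout N c p M
  length : ∀ e : Fin m, M.num 2 e = fieldLength c p e
  potential : ∀ v : Fin n, H (M.num 3 v)
  property : D fun v => φ (M.num 3 v)

theorem RelaxState.setReg {D : (Fin n → ℝ) → Prop} {M : Memory K}
    (h : RelaxState φ H N c p D M) {x : ℕ} (v : ℕ)
    (hx : x ∉ ({0, 1, 2, 3, 8} : Finset ℕ)) : RelaxState φ H N c p D (M.setReg x v) :=
  ⟨h.layout.setReg v hx, h.length, h.potential, h.property⟩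

theorem RelaxState.mono {D D' : (Fin n → ℝ) → Prop} {M : Memory K}
    (h : RelaxState φ H N c p D M) (hD : ∀ d, D d → D' d) : RelaxState φ H N c p D' M :=
  ⟨h.layout, h.length, h.potential, hD _ h.property⟩

/-- A sum is stored as a potential only if it is below the old value, hence at most `1`; this is
what `WeightBound.add` needs to preserve `H`. A rejected sum is covered by `weight_add`. -/
theorem runs_relax (hφ : StrictMono φ) (hw : WeightBound c p φ w W H)
    {D D' : (Fin n → ℝ) → Prop} (e : Fin m) (hD : ∀ d, D d → (∀ v, d v ≤ 1) ∧
      D' (Function.update d (N.src e) (min (d (N.src e)) (d (N.tgt e) + φ (fieldLength c p e)))))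
    {M : Memory K} (hM : RelaxState φ H N c p D M) (h5 : M.reg 5 = e) :
    Runs w relaxProg (2 + 3 * (1 + 3 * W)) M fun M' =>
      RelaxState φ H N c p D' M' ∧ M'.reg 5 = M.reg 5 ∧ M'.reg 4 = M.reg 4 := by
  obtain ⟨hlay, hlen, hpot, hprop⟩ := hM
  obtain ⟨hle, hupd⟩ := hD _ hprop
  have hcost₀ := hw.weight 0 hw.zero
  have hsrc := hw.weight _ (hpot (N.src e))
  have htgt := hw.weight _ (hpot (N.tgt e))
  have hadd := hw.weight_add _ e (hpot (N.tgt e))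
  have hlength := hw.weight_length e
  set x := M.num 3 (N.tgt e) + fieldLength c p e with hx
  let M₁ : Memory K := ((M.setReg 6 (N.src e)).setReg 7 (N.tgt e)).setNum 5 0 x
  have hM₁ : Layout N c p M₁ :=
    ((hlay.setReg _ (by decide)).setReg _ (by decide)).setNum _ _ (by decide)
  have h6 : M₁.reg 6 = N.src e := by simp [M₁, Memory.setReg, Memory.setNum]
  have h3 : M₁.num 3 = M.num 3 := by simp [M₁, Memory.setReg, Memory.setNum]
  have h2 : M₁.num 2 = M.num 2 := by simp [M₁, Memory.setReg, Memory.setNum]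
  have h50 : M₁.num 5 0 = x := by simp [M₁, Memory.setReg, Memory.setNum]
  have hr5 : M₁.reg 5 = M.reg 5 := by simp [M₁, Memory.setReg, Memory.setNum]
  have hr4 : M₁.reg 4 = M.reg 4 := by simp [M₁, Memory.setReg, Memory.setNum]
  have hφx : φ x = φ (M.num 3 (N.tgt e)) + φ (fieldLength c p e) := map_add φ _ _
  -- Two loads, the addition, the comparison and the conditional copy; each of the last three
  -- touches at most three numbers.
  rw [show 2 + 3 * (1 + 3 * W) = 1 + (1 + ((1 + 3 * W) + ((1 + 3 * W) + (1 + 3 * W)))) by ring]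
  refine Runs.instr_seq le_rfl (Runs.instr_seq le_rfl ?_)
  rw [show Instr.run (Instr.run M (.load 6 0 5)) (.load 7 1 5) =
    (M.setReg 6 (N.src e)).setReg 7 (N.tgt e) by
      simp [Instr.run, Memory.setReg, h5, hlay.arr_zero, hlay.arr_one]]
  refine Runs.instr_seq ?_ ?_
  · simp [Instr.cost, Memory.setReg, Op.apply, h5, hlen, ← hx]
    omega
  rw [show Instr.run ((M.setReg 6 (N.src e)).setReg 7 (N.tgt e)) (.numOp .add 5 8 3 7 2 5) = M₁ by
    simp [M₁, Instr.run, Memory.setReg, Op.apply, h5, hlen, hlay.reg_eight, ← hx]]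
  refine Runs.ite ?_ (fun hb => ?_) fun hb => ?_
  · simp only [Test.cost, h6, hM₁.reg_eight, h3, h50]
    omega
  · simp only [Test.Holds, h6, hM₁.reg_eight, h3, h50] at hb
    refine (Runs.skip ⟨⟨hM₁, h2 ▸ hlen, h3 ▸ hpot, ?_⟩, hr5, hr4⟩).mono (Nat.zero_le _)
      fun _ h => h
    rw [h3]
    rwa [← hφx, min_eq_left (hφ.monotone hb), Function.update_eq_self] at hupd
  · simp only [Test.Holds, h6, hM₁.reg_eight, h3, h50] at hb
    have hlt := hφ (not_le.1 hb)
    -- Array `4` is never written, so adding its entry `0` serves as a move instruction.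
    have hrun : Instr.run M₁ (.numOp .add 3 6 5 8 4 8) = M₁.setNum 3 (N.src e) x := by
      simp [Instr.run, Op.apply, h6, hM₁.reg_eight, hM₁.num_four, h50]
    refine Runs.instr ?_ ?_
    · simp only [Instr.cost, Op.apply, hM₁.reg_eight, hM₁.num_four, h50, add_zero]
      omega
    · rw [hrun]
      have hnew (v : Fin n) : (M₁.setNum 3 (N.src e) x).num 3 v =
          Function.update (fun u : Fin n => M.num 3 u) (N.src e) x v := by
        by_cases hv : v = N.src e
        · simp [Memory.setNum, hv]
        · simp [Memory.setNum, hv, h3, Fin.val_inj]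
      refine ⟨⟨hM₁.setNum _ _ (by decide), ?_, fun v => ?_, ?_⟩, hr5, hr4⟩
      · simpa [Memory.setNum, h2] using hlen
      · rw [hnew]
        by_cases hv : v = N.src e
        · rw [hv, Function.update_self]
          exact hw.add _ e (hpot _) (hlt.le.trans (hle _))
        · rw [Function.update_of_ne hv]
          exact hpot v
      · rw [← hφx, min_eq_right hlt.le] at hupd
        convert hupd using 1
        funext v
        rw [hnew]
        by_cases hv : v = N.src e
        · rw [hv, Function.update_self, Function.update_self]
        · rw [Function.update_of_ne hv, Function.update_of_ne hv]

theorem runs_round (hφ : StrictMono φ) (hw : WeightBound c p φ w W H) (k : ℕ)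
    {M : Memory K} (hM : RelaxState φ H N c p
      (N.Between (fun e => φ (fieldLength c p e)) k) M) :
    Runs w (forLoop 5 1 relaxProg) (2 + m * (2 + 3 * (1 + 3 * W) + 2)) M fun M' =>
      RelaxState φ H N c p (N.Between (fun e => φ (fieldLength c p e)) (k + 1)) M' ∧
        M'.reg 4 = M.reg 4 := by
  refine (Runs.forLoop (fun i M' => (RelaxState φ H N c p
    (N.Improved (fun e => φ (fieldLength c p e)) k {e | (e : ℕ) < i}) M' ∧
      M'.reg 4 = M.reg 4) ∧ M'.reg 5 = i) ?_ ?_ ?_).mono le_rfl ?_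
  · exact fun i M h => ⟨h.2, h.1.1.layout.reg_one⟩
  · refine ⟨⟨(hM.setReg 0 (by decide)).mono fun d hd => ⟨hd, fun e he => ?_⟩, rfl⟩,
      Memory.setReg_reg_self ..⟩
    exact absurd he (Nat.not_lt_zero _)
  · rintro i M' hi ⟨⟨hM', h4⟩, h5⟩
    refine (runs_relax hφ hw ⟨i, hi⟩ (D' := N.Improved (fun e => φ (fieldLength c p e)) k
      {e | (e : ℕ) < i + 1}) (fun d hd => ⟨hd.1.le_one, ?_⟩) hM' h5).mono le_rfl ?_
    · have := hd.relax ⟨i, hi⟩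
      refine ⟨this.1, fun e he => this.2 e ?_⟩
      rcases Nat.lt_succ_iff_lt_or_eq.1 he with he | he
      · exact .inr he
      · exact .inl (Fin.ext he)
    · rintro M'' ⟨hM'', h5', h4'⟩
      refine ⟨⟨hM''.setReg _ (by decide), ?_⟩, ?_⟩
      · simpa [Memory.setReg, h4'] using h4
      · simp [Memory.setReg, h5', h5]
  · rintro M' ⟨⟨hM', h4⟩, -⟩
    exact ⟨hM'.mono fun d hd => Improved.between ⟨hd.1, fun e _ => hd.2 e e.2⟩, h4⟩

theorem runs_rounds (hφ : StrictMono φ) (hw : WeightBound c p φ w W H)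
    {M : Memory K} (hM : RelaxState φ H N c p
      (N.Between (fun e => φ (fieldLength c p e)) 0) M) :
    Runs w (forLoop 4 0 (forLoop 5 1 relaxProg))
      (2 + n * (2 + m * (2 + 3 * (1 + 3 * W) + 2) + 2)) M
      (RelaxState φ H N c p (N.Between (fun e => φ (fieldLength c p e)) n)) := by
  refine (Runs.forLoop (fun i M' => RelaxState φ H N c p
    (N.Between (fun e => φ (fieldLength c p e)) i) M' ∧ M'.reg 4 = i) ?_ ?_ ?_).mono le_rfl ?_
  · exact fun i M h => ⟨h.2, h.1.layout.reg_zero⟩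
  · exact ⟨hM.setReg 0 (by decide), Memory.setReg_reg_self ..⟩
  · rintro i M' hi ⟨hM', h4⟩
    refine (runs_round hφ hw i hM').mono le_rfl ?_
    rintro M'' ⟨hM'', h4'⟩
    exact ⟨hM''.setReg _ (by decide), by simp [Memory.setReg, h4', h4]⟩
  · exact fun M' h => h.1

theorem runs_answer (hφ : StrictMono φ) (hw : WeightBound c p φ w W H)
    {D : (Fin n → ℝ) → Prop} {M : Memory K} (hM : RelaxState φ H N c p D M) :
    Runs w answerProg (1 + ((1 + 3 * W) + 2)) M fun M' =>
      (∀ e : Fin m, M'.num 2 e = fieldLength c p e) ∧ (D fun v => φ (M'.num 3 v)) ∧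
        M'.reg 0 = if 1 ≤ φ (M'.num 3 N.s) then 1 else 0 := by
  obtain ⟨hlay, hlen, hpot, hprop⟩ := hM
  have hs := hw.weight _ (hpot N.s)
  have hcost₁ := hw.weight 1 hw.one
  have h8 : (M.setNum 6 0 1).reg 8 = 0 := hlay.reg_eight
  have hr2 : (M.setNum 6 0 1).reg 2 = N.s := hlay.reg_two
  have h6 : (M.setNum 6 0 1).num 6 0 = 1 := by simp [Memory.setNum]
  have h3 : (M.setNum 6 0 1).num 3 = M.num 3 := by simp [Memory.setNum]
  have h2 : (M.setNum 6 0 1).num 2 = M.num 2 := by simp [Memory.setNum]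
  refine Runs.instr_seq le_rfl ?_
  rw [show Instr.run M (.numOne 6 8) = M.setNum 6 0 1 by simp [Instr.run, hlay.reg_eight]]
  have hiff : Test.Holds (M.setNum 6 0 1) (.numLe 6 8 3 2) ↔ 1 ≤ φ (M.num 3 N.s) := by
    simp only [Test.Holds, h8, hr2, h6, h3]
    rw [← hφ.le_iff_le, map_one]
  refine Runs.ite ?_ (fun hb => ?_) fun hb => ?_
  · simp only [Test.cost, h8, hr2, h6, h3]
    omega
  · refine (Runs.instr_seq (C := 1) (C' := 1) le_rfl (Runs.instr le_rfl ?_)).mono le_rfl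
      fun _ h => h
    refine ⟨?_, ?_, ?_⟩
    · simpa [Instr.run, Memory.setReg, h2] using hlen
    · simpa [Instr.run, Memory.setReg, h3] using hprop
    · simp [Instr.run, Memory.setReg, h3, hiff.1 hb]
  · refine (Runs.instr (C := 1) le_rfl ?_).mono (by omega) fun _ h => h
    refine ⟨?_, ?_, ?_⟩
    · simpa [Instr.run, Memory.setReg, h2] using hlen
    · simpa [Instr.run, Memory.setReg, h3] using hprop
    · simpa [Instr.run, Memory.setReg, h3] using fun h => hb (hiff.2 h)

theorem runs_decisionProg (hφ : StrictMono φ) (hw : WeightBound c p φ w W H)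
    (hc : ∀ e, N.c e = φ (c e)) (hp : N.IsImputation fun e => φ (p e)) :
    Runs w decisionProg (20 * (1 + 3 * W) * (n + m + 1) ^ 2) (N.inputMemory c p) fun M =>
      N.Decides (fun e => φ (p e)) (M.reg 0) (fun e => φ (M.num 2 e)) fun v => φ (M.num 3 v) := by
  refine Runs.mono (Runs.seq (runs_lengths hw layout_inputMemory) fun M₁ hM₁ =>
    Runs.seq (runs_start hM₁) fun M₂ hM₂ => Runs.instr_seq (C := 1) le_rfl <|
      Runs.seq (runs_rounds (N := N) hφ hw ?_) fun M₃ hM₃ => runs_answer hφ hw hM₃) ?_ ?_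
  · obtain ⟨⟨hlay, hlen⟩, hone⟩ := hM₂
    have hnew (v : Fin n) : (Instr.run M₂ (.numZero 3 3)).num 3 v = if v = N.t then 0 else 1 := by
      by_cases hv : v = N.t
      · simp [Instr.run, Memory.setNum, hv, hlay.reg_three]
      · simp [Instr.run, Memory.setNum, hv, hlay.reg_three, Fin.val_inj, hone]
    refine ⟨hlay.setNum _ _ (by decide), ?_, fun v => ?_, ?_⟩
    · simpa [Instr.run, Memory.setNum] using hlen
    · rw [hnew]
      split_ifs
      exacts [hw.zero, hw.one]
    · convert between_start (N := N) using 1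
      funext v
      rw [hnew, startPotential]
      split_ifs <;> simp
  · obtain ⟨B, hB⟩ : ∃ B, B = 1 + 3 * W := ⟨_, rfl⟩
    have h1 : 1 ≤ B := by omega
    have h2 := Nat.mul_le_mul_left n h1
    have h3 := Nat.mul_le_mul_left m h1
    have h4 := Nat.mul_le_mul_left (n * m) h1
    rw [← hB]
    ring_nf at h2 h3 h4 ⊢
    linarith [Nat.zero_le (B * n ^ 2), Nat.zero_le (B * m ^ 2), Nat.zero_le (n * B),
      Nat.zero_le (B * m), Nat.zero_le (n * B * m)]
  · rintro M ⟨h2, h3, h0⟩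
    have hδ : (fun e : Fin m => φ (fieldLength c p e)) =
        N.decisionLength fun e => φ (p e) := funext (map_fieldLength hφ hc)
    simp only [h2]
    rw [h0, hδ]
    rw [hδ] at h3
    exact decides_of_between hp h3

end Verification

end FlowNetwork

namespace Ram

/-! ### Bit lengths -/

/-- The reduced denominator divides `D`, and the numerator is at most `|x|` times that denominator.
The `+ 1` arises because `Nat.size_le` asks for a strict inequality. -/
theorem bitLength_le {x : ℚ} {D L A : ℕ} (hD : 0 < D) (hDL : D ≤ 2 ^ L)
    (hx : ∃ z : ℤ, x * D = z) (hA : |x| ≤ 2 ^ A) : bitLength x ≤ (A + L + 1) + (L + 1) := by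
  obtain ⟨z, hz⟩ := hx
  have hD' : (D : ℚ) ≠ 0 := by positivity
  have hden : x.den ∣ D := by
    have h := Rat.den_dvd z D
    rwa [Rat.divInt_eq_div, Int.cast_natCast, ← hz, mul_div_cancel_right₀ _ hD',
      Int.natCast_dvd_natCast] at h
  have hden' : x.den ≤ 2 ^ L := (Nat.le_of_dvd hD hden).trans hDL
  have hnum : x.num.natAbs ≤ 2 ^ (A + L) := by
    have h1 : |(x.num : ℚ)| = |x| * x.den := by
      rw [← Rat.mul_den_eq_num x, abs_mul, Nat.abs_cast]
    have h2 : (x.num.natAbs : ℚ) ≤ ((2 ^ (A + L) : ℕ) : ℚ) := by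
      rw [Nat.cast_natAbs, Int.cast_abs, h1, pow_add]
      push_cast
      exact mul_le_mul hA (by exact_mod_cast hden') (by positivity) (by positivity)
    exact_mod_cast h2
  refine add_le_add (Nat.size_le.2 (hnum.trans_lt ?_)) (Nat.size_le.2 (hden'.trans_lt ?_)) <;>
    exact Nat.pow_lt_pow_right (by norm_num) (Nat.lt_succ_self _)

theorem natAbs_num_mul_den_le (x y : ℚ) :
    x.num.natAbs * y.den ≤ 2 ^ (bitLength x + bitLength y) := by
  calc x.num.natAbs * y.den ≤ 2 ^ Nat.size x.num.natAbs * 2 ^ Nat.size y.den :=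
        Nat.mul_le_mul (Nat.lt_size_self _).le (Nat.lt_size_self _).le
    _ = 2 ^ (Nat.size x.num.natAbs + Nat.size y.den) := (pow_add ..).symm
    _ ≤ _ := Nat.pow_le_pow_right (by norm_num) (by simp only [bitLength]; omega)

theorem abs_div_le (x : ℚ) {y : ℚ} (hy : y ≠ 0) :
    |x / y| ≤ 2 ^ (bitLength x + bitLength y) := by
  have hy' : y.num.natAbs ≠ 0 := by simpa using hy
  have h1 : |x / y| = (x.num.natAbs * y.den : ℕ) / (x.den * y.num.natAbs : ℕ) := by
    conv_lhs => rw [← Rat.num_div_den x, ← Rat.num_div_den y]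
    rw [abs_div, abs_div, abs_div]
    push_cast
    rw [Nat.abs_cast, Nat.abs_cast, Nat.cast_natAbs, Nat.cast_natAbs, Int.cast_abs, Int.cast_abs]
    field_simp
  rw [h1]
  refine (div_le_self (by positivity) ?_).trans (by exact_mod_cast natAbs_num_mul_den_le x y)
  exact_mod_cast Nat.mul_pos x.den_pos (Nat.pos_of_ne_zero hy')

theorem den_div_le (x : ℚ) {y : ℚ} (hy : y ≠ 0) :
    (x / y).den ≤ 2 ^ (bitLength x + bitLength y) := by
  have hy' : y.num.natAbs ≠ 0 := by simpa using hy
  have h1 : x / y = Rat.divInt (x.num * y.den) (x.den * y.num) := by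
    rw [Rat.divInt_eq_div]
    conv_lhs => rw [← Rat.num_div_den x, ← Rat.num_div_den y]
    push_cast
    field_simp
  have h2 : (x / y).den ∣ y.num.natAbs * x.den := by
    have := Int.natAbs_dvd_natAbs.2 (Rat.den_dvd (x.num * y.den) (x.den * y.num))
    rwa [← h1, Int.natAbs_natCast, Int.natAbs_mul, Int.natAbs_natCast, mul_comm] at this
  rw [add_comm]
  exact (Nat.le_of_dvd (Nat.mul_pos (Nat.pos_of_ne_zero hy') x.den_pos) h2).trans
    (natAbs_num_mul_den_le y x)

end Ram

namespace FlowNetwork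

open Ram

/-! ### Sizes of the numbers in the rational computation -/

section Rational

variable {m : ℕ} {c p : Fin m → ℚ}

/-- The length of the input. -/
def inputLength (c p : Fin m → ℚ) : ℕ := ∑ e, (bitLength (c e) + bitLength (p e))

/-- A common denominator of the lengths of the edges. -/
def commonDen (c p : Fin m → ℚ) : ℕ := ∏ e, (fieldLength c p e).den

theorem bitLength_le_inputLength (e : Fin m) :
    bitLength (c e) + bitLength (p e) ≤ inputLength c p :=
  Finset.single_le_sum (f := fun e => bitLength (c e) + bitLength (p e))
    (fun _ _ => Nat.zero_le _) (Finset.mem_univ e)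

theorem commonDen_pos : 0 < commonDen c p := Finset.prod_pos fun _ _ => Rat.den_pos _

/-- The denominator of each quotient is bounded by two to the power of the bit length of its data;
the exponents add up in the product. -/
theorem commonDen_le : commonDen c p ≤ 2 ^ inputLength c p := by
  rw [inputLength, ← Finset.prod_pow_eq_pow_sum]
  refine Finset.prod_le_prod' fun e _ => ?_
  rw [fieldLength]
  split_ifs with h
  · exact Nat.one_le_two_pow
  · rw [add_comm]
    exact den_div_le _ (not_le.1 h).ne'

theorem exists_fieldLength_mul (e : Fin m) :
    ∃ z : ℤ, fieldLength c p e * commonDen c p = z := by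
  obtain ⟨k, hk⟩ := Finset.dvd_prod_of_mem (fun e => (fieldLength c p e).den) (Finset.mem_univ e)
  refine ⟨(fieldLength c p e).num * k, ?_⟩
  rw [commonDen, hk]
  push_cast
  rw [← mul_assoc, Rat.mul_den_eq_num]

theorem abs_fieldLength_le (e : Fin m) : |fieldLength c p e| ≤ 2 ^ inputLength c p := by
  rw [fieldLength]
  split_ifs with h
  · rw [abs_one]
    exact one_le_pow₀ (by norm_num)
  · refine (abs_div_le _ (not_le.1 h).ne').trans (pow_le_pow_right₀ (by norm_num) ?_)
    rw [add_comm]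
    exact bitLength_le_inputLength e

theorem fieldLength_nonneg (hp : ∀ e, 0 ≤ p e) (e : Fin m) : 0 ≤ fieldLength c p e := by
  rw [fieldLength]
  split_ifs with h
  · exact zero_le_one
  · exact div_nonneg (hp e) (not_le.1 h).le

/-- All potentials are multiples of one fixed fraction in `[0, 1]`, so their size does not grow with
the rounds. The bound `3 * inputLength c p + 3` is attained by the estimate for an unstored sum,
whose absolute value may reach `2 ^ (inputLength c p + 1)`. -/
theorem weightBound_bitLength (hp : ∀ e, 0 ≤ p e) :
    WeightBound c p (Rat.castHom ℝ) bitLength (3 * inputLength c p + 3)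
      fun x => 0 ≤ x ∧ x ≤ 1 ∧ ∃ z : ℤ, x * commonDen c p = z := by
  have hsum {x : ℚ} (e : Fin m) (hx : ∃ z : ℤ, x * commonDen c p = z) :
      ∃ z : ℤ, (x + fieldLength c p e) * commonDen c p = z := by
    obtain ⟨y, hy⟩ := hx
    obtain ⟨z, hz⟩ := exists_fieldLength_mul (c := c) (p := p) e
    exact ⟨y + z, by rw [add_mul, hy, hz]; push_cast; rfl⟩
  have hcp := bitLength_le_inputLength (c := c) (p := p)
  refine ⟨⟨le_rfl, zero_le_one, 0, by simp⟩, ⟨zero_le_one, le_rfl, commonDen c p, by simp⟩,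
    ?_, ?_, ?_, fun e => by have := hcp e; omega, fun e => by have := hcp e; omega, fun e => ?_⟩
  · rintro x e ⟨h0, -, hz⟩ h1
    refine ⟨add_nonneg h0 (fieldLength_nonneg hp e), (Rat.cast_le (K := ℝ)).1 ?_, hsum e hz⟩
    rw [Rat.cast_one]
    exact h1
  · rintro x ⟨h0, h1, hz⟩
    refine (bitLength_le (A := 0) commonDen_pos commonDen_le hz ?_).trans (by omega)
    rwa [pow_zero, abs_of_nonneg h0]
  · rintro x e ⟨h0, h1, hz⟩
    refine (bitLength_le (A := inputLength c p + 1) commonDen_pos commonDen_le (hsum e hz)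
      ?_).trans (by omega)
    refine (abs_add_le _ _).trans ?_
    rw [abs_of_nonneg h0, pow_succ, mul_two]
    exact add_le_add (h1.trans (one_le_pow₀ (by norm_num))) (abs_fieldLength_le e)
  · exact (bitLength_le commonDen_pos commonDen_le (exists_fieldLength_mul e)
      (abs_fieldLength_le e)).trans (by omega)

end Rational

theorem weightBound_unitCost {m : ℕ} (c p : Fin m → ℝ) :
    WeightBound c p (RingHom.id ℝ) unitCost 0 fun _ => True := by
  constructor <;> simp [unitCost]

theorem exists_polynomial_decision : ∃ (P : Ram.Prog) (T B : Polynomial ℕ),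
    ∀ (n m : ℕ) (N : FlowNetwork (Fin n) (Fin m)) (p : Fin m → ℝ), N.IsImputation p →
      (∃ (k : ℕ) (M : Ram.Memory ℝ), k ≤ T.eval (n + m) ∧
        Ram.Exec Ram.unitCost P (N.inputMemory N.c p) k M ∧
        N.Decides p (M.reg 0) (fun e => M.num 2 e) (fun v => M.num 3 v)) ∧
      (∀ c' p' : Fin m → ℚ, (∀ e, N.c e = (c' e : ℝ)) → (∀ e, p e = (p' e : ℝ)) →
        ∃ (k : ℕ) (M : Ram.Memory ℚ),
          k ≤ B.eval (n + m + ∑ e, (Ram.bitLength (c' e) + Ram.bitLength (p' e))) ∧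
          Ram.Exec Ram.bitLength P (N.inputMemory c' p') k M ∧
          N.Decides p (M.reg 0) (fun e => (M.num 2 e : ℝ)) (fun v => (M.num 3 v : ℝ))) := by
  -- The cost `20 * (1 + 3 * W) * (n + m + 1) ^ 2` with `W = 0` for unit cost and `W = 3 * L + 3`
  -- for input length `L`, where `1 + 3 * W = 9 * L + 10`.
  refine ⟨decisionProg, 20 * (Polynomial.X + 1) ^ 2,
    20 * (9 * Polynomial.X + 10) * (Polynomial.X + 1) ^ 2, fun n m N p hp => ⟨?_, ?_⟩⟩
  · obtain ⟨k, M, hk, hM, hdec⟩ := runs_decisionProg (φ := RingHom.id ℝ) strictMono_id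
      (weightBound_unitCost N.c p) (fun _ => rfl) hp
    exact ⟨k, M, by simpa using hk, hM, hdec⟩
  · intro c' p' hc' hp'
    obtain rfl : p = fun e => (p' e : ℝ) := funext hp'
    obtain ⟨k, M, hk, hM, hdec⟩ := runs_decisionProg (φ := Rat.castHom ℝ) Rat.cast_strictMono
      (weightBound_bitLength (c := c') fun e => (Rat.cast_nonneg (K := ℝ)).1 (hp.1 e)) hc' hp
    refine ⟨k, M, hk.trans ?_, hM, hdec⟩
    rw [← inputLength]
    simp only [Polynomial.eval_mul, Polynomial.eval_pow, Polynomial.eval_add, Polynomial.eval_X,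
      Polynomial.eval_one, Polynomial.eval_ofNat]
    gcongr ?_ * ?_ ^ 2
    · omega
    · omega

end FlowNetwork

theorem mainTheorem8 :
    -- Membership in the Owen set is decided in strongly polynomial time: the output is in
    -- register 0 and in the number arrays 2 (lengths) and 3 (potentials).
    (∃ (P : Ram.Prog) (T B : Polynomial ℕ),
      ∀ (n m : ℕ) (N : FlowNetwork (Fin n) (Fin m)) (p : Fin m → ℝ), N.IsImputation p →
        -- real data, a polynomial number of arithmetic steps
        (∃ (k : ℕ) (M : Ram.Memory ℝ), k ≤ T.eval (n + m) ∧
          Ram.Exec Ram.unitCost P (N.inputMemory N.c p) k M ∧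
          N.Decides p (M.reg 0) (fun e => M.num 2 e) (fun v => M.num 3 v)) ∧
        -- rational data, a bit cost that is polynomial in the length of the input
        (∀ c' p' : Fin m → ℚ, (∀ e, N.c e = (c' e : ℝ)) → (∀ e, p e = (p' e : ℝ)) →
          ∃ (k : ℕ) (M : Ram.Memory ℚ),
            k ≤ B.eval (n + m + ∑ e, (Ram.bitLength (c' e) + Ram.bitLength (p' e))) ∧
            Ram.Exec Ram.bitLength P (N.inputMemory c' p') k M ∧
            N.Decides p (M.reg 0) (fun e => (M.num 2 e : ℝ)) (fun v => (M.num 3 v : ℝ)))) ∧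
    -- The propagation algorithm, for positive capacities and any choice of the arcs.
    (∀ (V E : Type*) [Fintype V] [DecidableEq V] [Fintype E] (N : FlowNetwork V E)
      (f p : E → ℝ), (∀ e, 0 < N.c e) → N.IsMaxFlow f → N.IsImputation p →
        -- the loop makes fewer iterations than there are nodes
        (∀ k σ, N.Propagates f p k σ → k < Nat.card (N.PQNode f)) ∧
        -- at every stage, membership means that no inessential edge is paid and that the
        -- potentials fixed so far extend to a feasible dual solution
        (∀ k σ, N.Propagates f p k σ →
          (p ∈ N.owenSet ↔ (∀ e, ¬ N.Essential e → p e = 0) ∧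
            ∃ π : V → ℝ, (∀ v x, σ (N.node f v) = some x → π v = x) ∧
              N.DualFeasible (N.shareLength p) π)) ∧
        -- the fixed potentials are those of every optimal dual solution that yields `p` and
        -- vanishes at the sink
        (∀ k σ, N.Propagates f p k σ → ∀ δ π, N.DualOptimal δ π → (∀ e, p e = N.c e * δ e) →
          π N.t = 0 → ∀ v x, σ (N.node f v) = some x → π v = x) ∧
        -- if every node meets an essential edge, then the loop is never stuck ...
        ((∀ X : N.PQNode f, ∃ e, N.Essential e ∧
            (N.node f (N.src e) = X ∨ N.node f (N.tgt e) = X)) →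
          ∀ k σ, N.Propagates f p k σ → ¬ N.Finished f σ → ∃ σ', N.PropStep f p σ σ') ∧
        -- ... and whenever the loop ends, the answer is correct
        (∀ k σ, N.Propagates f p k σ → N.Finished f σ →
          (p ∈ N.owenSet ↔ N.AnswersYes f p σ))) := by
  exact ⟨FlowNetwork.exists_polynomial_decision, fun V E _ _ _ N f p hc hf hp =>
    ⟨fun _ _ hσ => hσ.lt_card, fun _ _ hσ => hσ.mem_owenSet_iff hf hp hc,
      fun _ _ hσ _ _ hopt hpδ ht v x hv => hσ.potential_eq hf hp hc hopt.1 hpδ ht v x hv,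
      fun hmeet _ _ hσ hfin => hσ.exists_propStep hf hc hmeet hfin,
      fun _ _ hσ hfin => hσ.answersYes_iff hf hp hc hfin⟩⟩
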